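/- Let $\Omega=\mathbb{Z}\omega_1\oplus\mathbb{Z}\omega_2\subset\mathbb{C}$ with $\omega_1,\omega_2$ linearly independent over $\mathbb{R}$, let $$\sigma(u;\Omega)=u\prod_{\omega\in\Omega\setminus\{0\}}\Bigl(1-\frac{u}{\omega}\Bigr)e^{\frac{u}{\omega}+\frac{u^2}{2\omega^2}}$$ be the Weierstrass sigma function, let $c\in\mathbb{C}$, and put $[u]=e^{2\pi\sqrt{-1}\,c u^2}\sigma(u;\Omega)$. Fix $\delta\in\mathbb{C}\setminus\{0\}$ with $\mathbb{Z}\delta\cap\Omega=\{0\}$. For $k=0,1,2,\ldots$ let $[u]_k=[u][u+\delta]\cdots[u+(k-1)\delta]$, and define $${}_{r+5}V_{r+4}(a_0;a_1,\ldots,a_r)=\sum_{k=0}^\infty\frac{[a_0+2k\delta]}{[a_0]}\frac{[a_0]_k}{[\delta]_k}\prod_{i=1}^r\frac{[a_i]_k}{[\delta+a_0-a_i]_k},$$ where the series is considered in the terminating case: if some $a_i=-K\delta$ with $K\in\mathbb{Z}_{\ge0}$, the terms with $k>K$ vanish. Let $M,N$ be non-negative integers, let $x,y,a_0,a_1,a_2,a_3\in\mathbb{C}$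 satisfy the balancing condition $\sum_{p=0}^3a_p=(N-M+1)\delta$, and put $b_p=\frac{\delta}{2}-a_p$ $(p=0,1,2,3)$. Then \begin{align*} &{}_{12}V_{11}\bigl(2x;\,x+\tfrac{\delta}{2}-a_0,\,x+\tfrac{\delta}{2}-a_1,\,x+\tfrac{\delta}{2}-a_2,\,x+\tfrac{\delta}{2}-a_3,\,x+y+\tfrac{\delta}{2}+N\delta,\,x-y+\tfrac{\delta}{2},\,-M\delta\bigr)\\ &=\prod_{p=1}^3\frac{[a_0+a_p]_M}{[(1-M)\delta-a_0-a_p]_N}\;\prod_{p=0}^3\frac{[y+\frac{\delta}{2}+b_p]_N}{[x+\frac{\delta}{2}+a_p]_M}\;\frac{[2x+\delta]_M}{[2y+\delta]_N}\;\frac{[y-x+\frac{\delta}{2}-M\delta]_N}{[y-x+\frac{\delta}{2}]_N}\\ &\quad\cdot{}_{12}V_{11}\bigl(2y;\,y+\tfrac{\delta}{2}-b_0,\,y+\tfrac{\delta}{2}-b_1,\,y+\tfrac{\delta}{2}-b_2,\,y+\tfrac{\delta}{2}-b_3,\,y+x+\tfrac{\delta}{2}+M\delta,\,y-x+\tfrac{\delta}{2},\,-N\delta\bigr),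 \end{align*} whenever none of the denominators occurring in the identity vanishes, that is, whenever $[2x]$, $[x+\frac{\delta}{2}+a_p]_M$ $(0\le p\le3)$, $[x-y+\frac{\delta}{2}-N\delta]_M$, $[x+y+\frac{\delta}{2}]_M$, $[2x+\delta+M\delta]_M$, $[2y]$, $[y+\frac{\delta}{2}+b_p]_N$ $(0\le p\le3)$, $[y-x+\frac{\delta}{2}-M\delta]_N$, $[y+x+\frac{\delta}{2}]_N$, $[2y+\delta+N\delta]_N$, $[(1-M)\delta-a_0-a_p]_N$ $(1\le p\le3)$, $[2y+\delta]_N$ and $[y-x+\frac{\delta}{2}]_N$ are all non-zero. -/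

import Mathlib

namespace EllipticHypergeometric

noncomputable section

/-- The Weierstrass sigma function of the period lattice `Ω = ℤω₁ ⊕ ℤω₂`:
`σ(u; Ω) = u ∏_{ω ∈ Ω, ω ≠ 0} (1 - u/ω) exp(u/ω + u²/(2ω²))`. -/
def weierstrassSigma (L : PeriodPair) (u : ℂ) : ℂ :=
  u * ∏' ω : {ω : ℂ // ω ∈ L.lattice ∧ ω ≠ 0},
    (1 - u / (ω : ℂ)) * Complex.exp (u / (ω : ℂ) + u ^ 2 / (2 * (ω : ℂ) ^ 2))

/-- The elliptic bracket `[u] = e(c u²) σ(u; Ω)`, where `e(z) = exp(2πi z)`. -/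
def bracket (L : PeriodPair) (c u : ℂ) : ℂ :=
  Complex.exp (2 * (Real.pi : ℂ) * Complex.I * (c * u ^ 2)) * weierstrassSigma L u

/-- The elliptic shifted factorial `[u]_k = [u][u+δ]⋯[u+(k-1)δ]`, for the bracket attached
to the lattice `L` and the constant `c`. -/
def shiftedFactorial (L : PeriodPair) (c δ u : ℂ) (k : ℕ) : ℂ :=
  ∏ j ∈ Finset.range k, bracket L c (u + (j : ℂ) * δ)

/-- The very well-poised elliptic hypergeometric series
`_{r+5}V_{r+4}(a₀; a₁, …, a_r)
  = ∑_{k ≥ 0} [a₀+2kδ]/[a₀] · [a₀]_k/[δ]_k · ∏_{i=1}^r [a_i]_k/[δ+a₀-a_i]_k`.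
The parameters `a₁, …, a_r` are given as the family `a : Fin r → ℂ`. If some `a_i` is `-Kδ` with
`K` a natural number, then all terms with `k > K` vanish, because `[-Kδ]_k` contains the
factor `[0] = 0`. -/
def ellipticV (L : PeriodPair) (c δ : ℂ) {r : ℕ} (a₀ : ℂ) (a : Fin r → ℂ) : ℂ :=
  ∑' k : ℕ,
    bracket L c (a₀ + 2 * (k : ℂ) * δ) / bracket L c a₀ *
      (shiftedFactorial L c δ a₀ k / shiftedFactorial L c δ δ k) *
      ∏ i, shiftedFactorial L c δ (a i) k / shiftedFactorial L c δ (δ + a₀ - a i) k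

end

end EllipticHypergeometric

/-! The algebra uses only two properties of the bracket: it is odd and satisfies the three-term
relation. For σ that relation is a polynomial identity in values of ℘, by σ(u+v)σ(u-v) =
σ(u)²σ(v)²(℘(v) - ℘(u)) (`weierstrassSigma_add_mul_sub`). The latter is Liouville's theorem for a
quotient that the quasi-periodicity of σ makes elliptic. Continuity and the zero set of σ serve only
to remove exceptional parameters.

Cleared of its parameter-dependent denominators, the left series is `wpSum`: M + 1 terms at z = x +
kδ, which depend on y through a kernel of N factors s(z+t)s(z-t). The right series is the same
object with M and N, x and y, a_p and δ/2 - a_p exchanged. Kernel degree and length thus trade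
places, and the claim becomes `Duality`, proved by induction on N for fixed M.

On the left, the three-term relation expands the newest kernel factor in two factors belonging to a₀
and a₁, each of which lowers its parameter by δ (`wpSum_succ_right`). On the right N is the length.
There an elliptic partial fraction identity with poles at ±(a₀-δ), ±(a₁-δ), ±(y+(N+1)δ) is summed
against the terms: one side telescopes to zero, the other is the matching recurrence
(`wpSum_succ_left`). Balancing is the condition for the partial fractions to hold, and it persists
because N and one parameter drop together. For N = 0, exchanging the two sums reduces to M = 0,
where the same induction starts from 1 = 1; that case is the Frenkel–Turaev summation in cleared
form.

The recurrences divide by brackets absent from the final formula, so they are proved for generic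
parameters. The general case follows by continuity along a complex line through the given point that
preserves balancing and is generic off a countable set. -/

namespace EllipticHypergeometric

open Filter Topology

/-! ### The sigma product and its logarithmic derivative. -/

noncomputable section

variable (L : PeriodPair)

/-- The primary factor `(1 - u/l) exp(u/l + u²/(2l²))`, equal to `1` for `l = 0`. -/
def sigmaFactor (l u : ℂ) : ℂ :=
  (1 - u / l) * Complex.exp (u / l + u ^ 2 / (2 * l ^ 2))

/-- The product of the primary factors over the whole lattice, that is, `σ(u)/u`. -/
def sigmaProd (u : ℂ) : ℂ := ∏' l : L.lattice, sigmaFactor l u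

theorem weierstrassSigma_eq (u : ℂ) : weierstrassSigma L u = u * sigmaProd L u := by
  unfold weierstrassSigma sigmaProd
  congr 1
  let e : {ω : ℂ // ω ∈ L.lattice ∧ ω ≠ 0} → L.lattice := fun ω ↦ ⟨ω, ω.2.1⟩
  have he : Function.Injective e := fun a b h ↦ by
    simpa [e, Subtype.ext_iff] using h
  refine (he.tprod_eq (f := fun l : L.lattice ↦ sigmaFactor l u) ?_)
  intro l hl
  refine ⟨⟨l, l.2, fun h ↦ hl ?_⟩, rfl⟩
  simp [sigmaFactor, h]

/-- The exponential cancels the Taylor polynomial of degree two of log(1 - u/l), so the logarithm of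
the factor is a cubic remainder. The exponent -3 is summable over a lattice of real rank two. -/
theorem norm_sigmaFactor_sub_one_le {l u : ℂ} {r : ℝ} (hu : ‖u‖ ≤ r) (hl : 2 * r ≤ ‖l‖) :
    ‖sigmaFactor l u - 1‖ ≤ 2 * r ^ 3 * ‖l‖ ^ (-3 : ℝ) := by
  have hr : 0 ≤ r := (norm_nonneg _).trans hu
  rcases eq_or_ne l 0 with rfl | hl0
  · simp only [sigmaFactor, div_zero, sub_zero, norm_zero]
    simp
  have hlp : 0 < ‖l‖ := norm_pos_iff.2 hl0
  set z := u / l with hz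
  have hzr : ‖z‖ ≤ r / ‖l‖ := by rw [hz, norm_div]; gcongr
  have hz2 : ‖z‖ ≤ 1 / 2 := hzr.trans (by rw [div_le_iff₀ hlp]; linarith)
  have hlog := Complex.norm_log_sub_logTaylor_le 2 (z := -z) (by rw [norm_neg]; linarith)
  have hT : Complex.logTaylor (2 + 1) (-z) = -z - z ^ 2 / 2 := by
    simp [Complex.logTaylor, Finset.sum_range_succ]
    ring
  rw [hT, norm_neg] at hlog
  set w := Complex.log (1 + -z) - (-z - z ^ 2 / 2) with hw
  have hne : 1 + -z ≠ 0 := fun h ↦ by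
    have : z = 1 := by linear_combination -h
    rw [this] at hz2; norm_num at hz2
  have hE : sigmaFactor l u = Complex.exp w := by
    rw [hw, Complex.exp_sub, Complex.exp_log hne, div_eq_mul_inv, ← Complex.exp_neg, sigmaFactor]
    congr 2
    rw [hz]; field_simp; ring
  have hinv : (1 - ‖z‖)⁻¹ ≤ 2 := by
    rw [inv_le_comm₀ (by linarith) (by norm_num)]; linarith
  have hwle : ‖w‖ ≤ ‖z‖ ^ 3 := by
    refine hlog.trans ?_
    have h3 : 0 ≤ ‖z‖ ^ 3 := by positivity
    norm_num
    nlinarith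
  have hw1 : ‖w‖ ≤ 1 := hwle.trans (pow_le_one₀ (norm_nonneg _) (by linarith))
  rw [hE]
  refine (Complex.norm_exp_sub_one_le hw1).trans ?_
  have : ‖z‖ ^ 3 ≤ (r / ‖l‖) ^ 3 := by gcongr
  rw [show (-3 : ℝ) = -((3 : ℕ) : ℝ) by norm_num, Real.rpow_neg hlp.le, Real.rpow_natCast]
  calc 2 * ‖w‖ ≤ 2 * (r / ‖l‖) ^ 3 := by linarith
    _ = _ := by rw [div_pow]; ring

theorem summable_norm_rpow_neg_three (C : ℝ) :
    Summable fun l : L.lattice ↦ C * ‖(l : ℂ)‖ ^ (-3 : ℝ) :=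
  (ZLattice.summable_norm_rpow _ _ (by simp; norm_num)).mul_left _

theorem eventually_cofinite_le_norm (R : ℝ) : ∀ᶠ l : L.lattice in cofinite, R ≤ ‖(l : ℂ)‖ := by
  have := (isCompact_iff_finite.mp (isCompact_closedBall (0 : L.lattice) R))
  refine this.subset fun l hl ↦ ?_
  simp only [Set.mem_compl_iff, Set.mem_ofPred_eq, not_le] at hl
  simpa using hl.le

theorem hasProdLocallyUniformlyOn_sigmaFactor {r : ℝ} :
    HasProdLocallyUniformlyOn (fun (l : L.lattice) u ↦ sigmaFactor l u) (sigmaProd L)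
      (Metric.ball 0 r) := by
  have := Summable.hasProdLocallyUniformlyOn_one_add (R := ℂ)
    (f := fun (l : L.lattice) u ↦ sigmaFactor l u - 1) (K := Metric.ball (0 : ℂ) r)
    Metric.isOpen_ball (summable_norm_rpow_neg_three L (2 * r ^ 3)) ?_ ?_
  · simp only [add_sub_cancel] at this
    exact this
  · filter_upwards [eventually_cofinite_le_norm L (2 * r)] with l hl u hu
    exact norm_sigmaFactor_sub_one_le (by simpa using (Metric.mem_ball.1 hu).le) hl
  · intro l
    unfold sigmaFactor
    fun_prop

theorem differentiable_sigmaFactor (l : ℂ) : Differentiable ℂ (sigmaFactor l) := by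
  unfold sigmaFactor
  fun_prop

theorem differentiable_sigmaProd : Differentiable ℂ (sigmaProd L) := fun u ↦ by
  have h := (hasProdLocallyUniformlyOn_sigmaFactor L (r := ‖u‖ + 1)).differentiableOn
    (.of_forall fun s ↦ .fun_finsetProd fun l _ ↦ (differentiable_sigmaFactor l).differentiableOn)
    Metric.isOpen_ball
  exact h.differentiableAt (Metric.isOpen_ball.mem_nhds (by simp))

theorem differentiable_weierstrassSigma : Differentiable ℂ (weierstrassSigma L) := by
  rw [funext (weierstrassSigma_eq L)]
  exact differentiable_id.mul (differentiable_sigmaProd L)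

theorem sigmaFactor_ne_zero {l u : ℂ} (h : l ≠ 0 → u ≠ l) : sigmaFactor l u ≠ 0 := by
  refine mul_ne_zero (fun h0 ↦ ?_) (Complex.exp_ne_zero _)
  rcases eq_or_ne l 0 with rfl | hl
  · simp at h0
  · apply h hl
    field_simp at h0
    linear_combination -h0

theorem sigmaProd_ne_zero {u : ℂ} (h : ∀ l ∈ L.lattice, l ≠ 0 → u ≠ l) : sigmaProd L u ≠ 0 := by
  have := tprod_one_add_ne_zero_of_summable (R := ℂ)
    (f := fun l : L.lattice ↦ sigmaFactor l u - 1)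
    (fun l ↦ by simpa using sigmaFactor_ne_zero (h l l.2)) ?_
  · simpa [sigmaProd] using this
  · refine (summable_norm_rpow_neg_three L (2 * ‖u‖ ^ 3)).of_norm_bounded_eventually ?_
    filter_upwards [eventually_cofinite_le_norm L (2 * ‖u‖)] with l hl
    simpa using norm_sigmaFactor_sub_one_le le_rfl hl

theorem sigmaProd_zero : sigmaProd L 0 = 1 := by
  simp [sigmaProd, sigmaFactor]

theorem sigmaProd_neg (u : ℂ) : sigmaProd L (-u) = sigmaProd L u := by
  unfold sigmaProd
  rw [← (Equiv.neg L.lattice).tprod_eq]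
  congr! 2 with l
  simp [sigmaFactor]

theorem weierstrassSigma_neg (u : ℂ) : weierstrassSigma L (-u) = -weierstrassSigma L u := by
  rw [weierstrassSigma_eq, weierstrassSigma_eq, sigmaProd_neg, neg_mul]

theorem weierstrassSigma_ne_zero {u : ℂ} (hu : u ∉ L.lattice) : weierstrassSigma L u ≠ 0 := by
  rw [weierstrassSigma_eq]
  refine mul_ne_zero ?_ (sigmaProd_ne_zero L fun l hl _ h ↦ hu (h ▸ hl))
  rintro rfl
  exact hu (zero_mem _)

theorem weierstrassSigma_zero : weierstrassSigma L 0 = 0 := by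
  rw [weierstrassSigma_eq, zero_mul]

/-- The summand `1/(u - l) + 1/l + u/l²` of the Weierstrass zeta function, equal to `1/u` for
`l = 0`. -/
def zetaSummand (l u : ℂ) : ℂ := 1 / (u - l) + 1 / l + u / l ^ 2

/-- The three fractions combine to u²/(l²(u - l)), and |u - l| ≥ |l|/2 in this range. -/
theorem norm_zetaSummand_le {l u : ℂ} {r : ℝ} (hr : 0 < r) (hu : ‖u‖ < r) (hl : 2 * r ≤ ‖l‖) :
    ‖zetaSummand l u‖ ≤ 2 * r ^ 2 * ‖l‖ ^ (-3 : ℝ) := by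
  have hlp : 0 < ‖l‖ := by linarith
  have hl0 : l ≠ 0 := norm_pos_iff.1 hlp
  have hd : ‖l‖ / 2 ≤ ‖u - l‖ := by
    have := norm_sub_norm_le l u
    rw [norm_sub_rev] at this
    linarith
  have hul : u - l ≠ 0 := norm_pos_iff.1 (by linarith)
  have : zetaSummand l u = u ^ 2 / (l ^ 2 * (u - l)) := by
    unfold zetaSummand
    field_simp
    ring
  rw [this, show (-3 : ℝ) = -((3 : ℕ) : ℝ) by norm_num, Real.rpow_neg hlp.le, Real.rpow_natCast]
  simp only [norm_div, norm_mul, norm_pow]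
  calc ‖u‖ ^ 2 / (‖l‖ ^ 2 * ‖u - l‖) ≤ r ^ 2 / (‖l‖ ^ 2 * (‖l‖ / 2)) := by gcongr
    _ = _ := by field_simp

theorem hasSumLocallyUniformly_zetaSummand :
    HasSumLocallyUniformly (fun (l : L.lattice) u ↦ zetaSummand l u)
      (fun u ↦ ∑' l : L.lattice, zetaSummand l u) := by
  refine L.hasSumLocallyUniformly_aux (u := fun r l ↦ 2 * r ^ 2 * ‖(l : ℂ)‖ ^ (-3 : ℝ)) _
    (fun r _ ↦ summable_norm_rpow_neg_three L _) fun r hr ↦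
    eventually_atTop.mpr ⟨2 * r, ?_⟩
  rintro _ h s hs l rfl
  exact norm_zetaSummand_le hr hs h

theorem summable_zetaSummand (u : ℂ) : Summable fun l : L.lattice ↦ zetaSummand l u :=
  (hasSumLocallyUniformly_zetaSummand L).hasSum.summable

theorem logDeriv_sigmaFactor {l u : ℂ} (hl : l ≠ 0) (hu : u ≠ l) :
    logDeriv (sigmaFactor l) u = zetaSummand l u := by
  have hul : u - l ≠ 0 := sub_ne_zero.2 hu
  have h1 : 1 - u / l ≠ 0 := fun h ↦ hul (by field_simp at h; linear_combination -h)
  have hd1 : HasDerivAt (fun u ↦ 1 - u / l) (-(1 / l)) u := by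
    simpa using ((hasDerivAt_id u).div_const l).const_sub 1
  have hd2 : HasDerivAt (fun u ↦ u / l + u ^ 2 / (2 * l ^ 2)) (1 / l + u / l ^ 2) u := by
    convert! ((hasDerivAt_id u).div_const l).add (((hasDerivAt_id u).pow 2).div_const (2 * l ^ 2))
      using 1
    simp
    field_simp
  have hd := hd1.mul hd2.cexp
  have : deriv (sigmaFactor l) u = _ := hd.deriv
  rw [logDeriv_apply, this, sigmaFactor, zetaSummand]
  have h2 := Complex.exp_ne_zero (u / l + u ^ 2 / (2 * l ^ 2))
  rw [div_eq_iff (mul_ne_zero h1 h2)]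
  have h3 : l - u ≠ 0 := sub_ne_zero.2 hu.symm
  field_simp
  ring

/-- The primary factor at l = 0 is constant and contributes nothing; the prefactor u contributes
1/u, which is exactly the summand at l = 0. -/
theorem logDeriv_weierstrassSigma {u : ℂ} (hu : u ∉ L.lattice) :
    logDeriv (weierstrassSigma L) u = ∑' l : L.lattice, zetaSummand l u := by
  have hu0 : u ≠ 0 := fun h ↦ hu (h ▸ zero_mem _)
  have hne (l : L.lattice) : u ≠ l := fun h ↦ hu (h ▸ l.2)
  have hterm (l : L.lattice) :
      logDeriv (sigmaFactor l) u = if l = 0 then 0 else zetaSummand l u := by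
    split_ifs with h
    · have : sigmaFactor (l : ℂ) = fun _ ↦ 1 := by
        ext; simp [h, sigmaFactor]
      rw [this]
      simp [logDeriv_apply]
    · exact logDeriv_sigmaFactor (by simpa using h) (hne l)
  have hs := summable_zetaSummand L u
  have hprod : logDeriv (sigmaProd L) u = ∑' l : L.lattice, logDeriv (sigmaFactor l) u := by
    have h := hasProdLocallyUniformlyOn_sigmaFactor L (r := ‖u‖ + 1)
    refine logDeriv_tprod_eq_tsum (Metric.isOpen_ball (x := 0) (ε := ‖u‖ + 1)) (by simp)
      (f := fun (l : L.lattice) u ↦ sigmaFactor l u)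
      (fun l ↦ sigmaFactor_ne_zero fun _ ↦ hne l)
      (fun l ↦ (differentiable_sigmaFactor l).differentiableOn) ?_
      h.multipliableLocallyUniformlyOn (sigmaProd_ne_zero L fun l hl _ h ↦ hu (h ▸ hl))
    simp_rw [hterm]
    exact (hs.hasSum.update 0 0).summable.congr fun l ↦ by simp [Function.update_apply]
  rw [funext (weierstrassSigma_eq L), logDeriv_mul (f := fun u ↦ u) u hu0
    (sigmaProd_ne_zero L fun l hl _ h ↦ hu (h ▸ hl)) (by fun_prop)
    (differentiable_sigmaProd L u), hprod, hs.tsum_eq_add_tsum_ite 0]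
  simp_rw [hterm]
  congr 1
  simp [zetaSummand, logDeriv_apply]

theorem deriv_tsum_zetaSummand {u : ℂ} (hu : u ∉ L.lattice) :
    deriv (fun u ↦ ∑' l : L.lattice, zetaSummand l u) u = -L.weierstrassP u := by
  have hdiff (l : L.lattice) {z : ℂ} (hz : z ∉ L.lattice) :
      HasDerivAt (zetaSummand l) (-(1 / (z - l) ^ 2 - 1 / (l : ℂ) ^ 2)) z := by
    have hzl : z - l ≠ 0 := fun h ↦ hz (by rw [sub_eq_zero.1 h]; exact l.2)
    convert! (((hasDerivAt_id z).sub_const (l : ℂ)).inv hzl).add_const (1 / (l : ℂ)) |>.add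
      ((hasDerivAt_id z).div_const ((l : ℂ) ^ 2)) using 1
    · ext; simp [zetaSummand]
    · simp; ring
  have hopen : IsOpen ((L.lattice : Set ℂ)ᶜ) := L.isClosed_lattice.isOpen_compl
  have h1 := (hasSumLocallyUniformly_zetaSummand L).tendstoLocallyUniformlyOn.deriv
    (U := (L.lattice : Set ℂ)ᶜ) (.of_forall fun s ↦ .fun_sum fun l _ z hz ↦
      (hdiff l hz).differentiableAt.differentiableWithinAt) hopen
  have h2 : Tendsto (fun s : Finset L.lattice ↦
      ∑ l ∈ s, -(1 / (u - (l : ℂ)) ^ 2 - 1 / (l : ℂ) ^ 2)) atTop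
      (𝓝 (deriv (fun u ↦ ∑' l : L.lattice, zetaSummand l u) u)) :=
    (h1.tendsto_at hu).congr (fun s ↦ by
    simp only [Function.comp_apply]
    rw [deriv_fun_sum fun l _ ↦ (hdiff l hu).differentiableAt]
    exact Finset.sum_congr rfl fun l _ ↦ (hdiff l hu).deriv)
  exact tendsto_nhds_unique h2 (L.hasSum_weierstrassP u).neg

end

/-! ### Quasi-periodicity, the addition formula and the three-term relation. -/

noncomputable section

variable (L : PeriodPair)

/-- Countability makes the complement of the lattice both dense and, in real dimension two,
connected. -/
theorem countable_lattice : (L.lattice : Set ℂ).Countable :=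
  countable_of_Lindelof_of_discrete (X := L.lattice)

theorem dense_compl_lattice : Dense ((L.lattice : Set ℂ)ᶜ) :=
  (countable_lattice L).dense_compl ℝ

theorem eq_zero_of_forall_notMem_lattice {f : ℂ → ℂ} {u : ℂ} (hf : Continuous f)
    (h : ∀ z, z ∉ L.lattice → f z = 0) : f u = 0 :=
  congrFun (hf.ext_on (dense_compl_lattice L) continuous_const fun z hz ↦ h z hz) u

theorem add_notMem_lattice {u l : ℂ} (hl : l ∈ L.lattice) (hu : u ∉ L.lattice) :
    u + l ∉ L.lattice :=
  fun h ↦ hu (by simpa using sub_mem h hl)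

/-- Since ℘ is periodic, Z(u + l) - Z(u) has zero derivative on the connected complement of the
lattice, hence is a constant η. So σ(u + l) and σ(u)exp(ηu) have equal logarithmic derivatives and
are proportional there; density extends this to all u. -/
theorem exists_weierstrassSigma_add {l : ℂ} (hl : l ∈ L.lattice) :
    ∃ C η : ℂ, C ≠ 0 ∧
      ∀ u, weierstrassSigma L (u + l) = C * (weierstrassSigma L u * Complex.exp (η * u)) := by
  have hopen : IsOpen ((L.lattice : Set ℂ)ᶜ) := L.isClosed_lattice.isOpen_compl
  have hconn : IsPreconnected ((L.lattice : Set ℂ)ᶜ) :=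
    ((countable_lattice L).isConnected_compl_of_one_lt_rank (by simp)).2
  set Z : ℂ → ℂ := fun u ↦ ∑' l : L.lattice, zetaSummand l u with hZ
  have hlog {u : ℂ} (hu : u ∉ L.lattice) : logDeriv (weierstrassSigma L) u = Z u :=
    logDeriv_weierstrassSigma L hu
  have hZd : DifferentiableOn ℂ Z (L.lattice : Set ℂ)ᶜ := by
    have : DifferentiableOn ℂ (logDeriv (weierstrassSigma L)) (L.lattice : Set ℂ)ᶜ := by
      intro u hu
      have hd : Differentiable ℂ (deriv (weierstrassSigma L)) :=
        ((differentiable_weierstrassSigma L).contDiff (n := 2)).differentiable_deriv_two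
      exact ((hd u).div (differentiable_weierstrassSigma L u)
        (weierstrassSigma_ne_zero L hu)).differentiableWithinAt
    exact this.congr fun u hu ↦ (hlog hu).symm
  have hmaps : Set.MapsTo (· + l) (L.lattice : Set ℂ)ᶜ (L.lattice : Set ℂ)ᶜ :=
    fun u hu ↦ add_notMem_lattice L hl hu
  obtain ⟨η, hη⟩ := hopen.exists_eq_add_of_deriv_eq (f := fun u ↦ Z (u + l)) (g := Z) hconn
    (hZd.comp (by fun_prop) hmaps) hZd (fun u hu ↦ by
      rw [deriv_comp_add_const, hZ, deriv_tsum_zetaSummand L hu,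
        deriv_tsum_zetaSummand L (hmaps hu)]
      exact congrArg _ (L.weierstrassP_add_coe u ⟨l, hl⟩))
  have hσ := differentiable_weierstrassSigma L
  have hexp : Differentiable ℂ fun u ↦ Complex.exp (η * u) := by fun_prop
  obtain ⟨C, hC0, hC⟩ := (logDeriv_eqOn_iff (f := fun u ↦ weierstrassSigma L (u + l))
    (g := fun u ↦ weierstrassSigma L u * Complex.exp (η * u)) (s := (L.lattice : Set ℂ)ᶜ)
    (hσ.comp (by fun_prop)).differentiableOn (hσ.mul hexp).differentiableOn hopen hconn
    (fun u hu ↦ mul_ne_zero (weierstrassSigma_ne_zero L hu) (Complex.exp_ne_zero _))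
    (fun u hu ↦ weierstrassSigma_ne_zero L (hmaps hu))).1 (fun u hu ↦ by
      have h1 : logDeriv (fun u ↦ weierstrassSigma L (u + l)) u = Z (u + l) := by
        rw [← hlog (hmaps hu), logDeriv_apply, logDeriv_apply, deriv_comp_add_const]
      have h2 : logDeriv (fun u ↦ Complex.exp (η * u)) u = η := by
        have : HasDerivAt (fun u ↦ Complex.exp (η * u)) (Complex.exp (η * u) * η) u := by
          simpa using ((hasDerivAt_id u).const_mul η).cexp
        rw [logDeriv_apply, this.deriv, mul_div_cancel_left₀ _ (Complex.exp_ne_zero _)]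
      rw [h1, logDeriv_mul (g := fun u ↦ Complex.exp (η * u)) u (weierstrassSigma_ne_zero L hu)
        (Complex.exp_ne_zero _) (hσ u) (hexp u), h2, hlog hu]
      exact hη hu)
  refine ⟨C, η, hC0, fun u ↦ ?_⟩
  refine congrFun (Continuous.ext_on (dense_compl_lattice L) (f := fun u ↦
    weierstrassSigma L (u + l)) (g := fun u ↦ C * (weierstrassSigma L u * Complex.exp (η * u)))
    (hσ.continuous.comp (by fun_prop)) (by have := hσ.continuous; fun_prop) fun u hu ↦ ?_) u
  simpa using hC hu

theorem weierstrassSigma_eq_zero_iff {u : ℂ} : weierstrassSigma L u = 0 ↔ u ∈ L.lattice := by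
  refine ⟨fun h ↦ by_contra fun hu ↦ weierstrassSigma_ne_zero L hu h, fun h ↦ ?_⟩
  obtain ⟨C, η, -, h1⟩ := exists_weierstrassSigma_add L h
  simpa [weierstrassSigma_zero] using h1 0

/-- An even function analytic at `0` and vanishing there is `z²` times an analytic function. -/
theorem exists_analyticAt_eq_sq_mul {f : ℂ → ℂ} (hf : AnalyticAt ℂ f 0)
    (hev : ∀ z, f (-z) = f z) (h0 : f 0 = 0) :
    ∃ g : ℂ → ℂ, AnalyticAt ℂ g 0 ∧ ∀ᶠ z in 𝓝 0, f z = z ^ 2 * g z := by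
  have hd : deriv f 0 = 0 := by
    have : deriv (fun z ↦ f (-z)) 0 = -deriv f 0 := by simp [deriv_comp_neg]
    rw [funext hev] at this
    simpa [CharZero.eq_neg_self_iff] using this
  have : (2 : ℕ) ≤ analyticOrderAt f 0 := by
    rw [natCast_le_analyticOrderAt_iff_iteratedDeriv_eq_zero hf]
    intro i hi
    interval_cases i
    · simpa using h0
    · simpa using hd
  obtain ⟨g, hg, h⟩ := (natCast_le_analyticOrderAt hf).1 this
  exact ⟨g, hg, by simpa using h⟩

/-- For fixed v, σ(u+v)σ(u-v)/σ(u)² + σ(v)²℘(u) is periodic in u and its double poles cancel, so it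
is constant by Liouville. At u = v the first summand vanishes, which gives the constant. -/
theorem weierstrassSigma_add_mul_sub {u v : ℂ} (hu : u ∉ L.lattice) (hv : v ∉ L.lattice) :
    weierstrassSigma L (u + v) * weierstrassSigma L (u - v) =
      weierstrassSigma L u ^ 2 * weierstrassSigma L v ^ 2 *
        (L.weierstrassP v - L.weierstrassP u) := by
  set σ := weierstrassSigma L with hσdef
  have hσ : Differentiable ℂ σ := differentiable_weierstrassSigma L
  have hneg (u : ℂ) : σ (-u) = -σ u := weierstrassSigma_neg L u
  set g : ℂ → ℂ := fun u ↦ σ (u + v) * σ (u - v) / σ u ^ 2 + σ v ^ 2 * L.weierstrassP u with hg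
  -- This is u² g(u) with the pole at 0 removed, from σ(u) = u · `sigmaProd` and u²℘(u) = u² ·
  -- `weierstrassPExcept` + 1. It is even and vanishes at 0, hence divisible by u².
  set n : ℂ → ℂ := fun u ↦ σ (u + v) * σ (u - v) / sigmaProd L u ^ 2 +
    σ v ^ 2 * (u ^ 2 * L.weierstrassPExcept 0 u + 1) with hn
  have hTd := differentiable_sigmaProd L
  have hn_an : AnalyticAt ℂ n 0 := by
    have h1 : AnalyticAt ℂ (L.weierstrassPExcept 0) 0 := L.analyticAt_weierstrassPExcept 0
    have h2 : AnalyticAt ℂ (fun u ↦ σ (u + v) * σ (u - v)) 0 :=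
      Differentiable.analyticAt (by fun_prop) 0
    have h3 : AnalyticAt ℂ (fun u ↦ sigmaProd L u ^ 2) 0 :=
      Differentiable.analyticAt (by fun_prop) 0
    exact (h2.div h3 (by simp [sigmaProd_zero])).add (by fun_prop)
  have hn_even (z : ℂ) : n (-z) = n z := by
    simp only [hn, sigmaProd_neg, L.weierstrassPExcept_neg, neg_zero]
    rw [show -z + v = -(z - v) by ring, show -z - v = -(z + v) by ring, hneg, hneg]
    ring
  have hn0 : n 0 = 0 := by
    simp [hn, sigmaProd_zero, hneg]
    ring
  obtain ⟨m, hm, hnm⟩ := exists_analyticAt_eq_sq_mul hn_an hn_even hn0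
  have hgm : ∀ᶠ z in 𝓝 0, z ≠ 0 → g z = m z := by
    filter_upwards [hnm, L.compl_lattice_sdiff_singleton_mem_nhds 0] with z hz hzL hz0
    have h1 := L.weierstrassPExcept_add (0 : L.lattice) z
    simp only [ZeroMemClass.coe_zero, sub_zero] at h1
    have h2 : sigmaProd L z ≠ 0 := sigmaProd_ne_zero L fun l hl hl0 h ↦ by
      subst h
      exact hzL ⟨hl, hl0⟩
    have h3 : z ^ 2 * g z = n z := by
      simp only [hg, hn, ← h1]
      rw [show σ z = z * sigmaProd L z from weierstrassSigma_eq L z]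
      field_simp
      simp
    rw [hz] at h3
    exact mul_left_cancel₀ (pow_ne_zero 2 hz0) h3
  have hper (l : ℂ) (hl : l ∈ L.lattice) (z : ℂ) : g (z + l) = g z := by
    obtain ⟨C, η, hC, h⟩ := exists_weierstrassSigma_add L hl
    simp only [hg, show L.weierstrassP (z + l) = L.weierstrassP z from
      L.weierstrassP_add_coe z ⟨l, hl⟩]
    congr 1
    rw [show z + l + v = z + v + l by ring, show z + l - v = z - v + l by ring]
    simp only [hσdef, h]
    rw [← hσdef, mul_add, mul_sub, Complex.exp_add, Complex.exp_sub]
    have := Complex.exp_ne_zero (η * v)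
    have := Complex.exp_ne_zero (η * z)
    by_cases hz : σ z = 0
    · simp [hz]
    · field_simp
  classical
  -- By periodicity, the removable value at 0 serves at every lattice point.
  set G : ℂ → ℂ := fun z ↦ if z ∈ L.lattice then m 0 else g z with hG
  have hGper (z l : ℂ) (hl : l ∈ L.lattice) : G (z + l) = G z := by
    have : z + l ∈ L.lattice ↔ z ∈ L.lattice :=
      L.lattice.toAddSubgroup.add_mem_cancel_right (y := z) hl
    simp only [hG, this, hper l hl]
  have hG0 : AnalyticAt ℂ G 0 := by
    refine hm.congr ?_
    filter_upwards [hgm, L.compl_lattice_sdiff_singleton_mem_nhds 0] with z hz hzL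
    by_cases hz0 : z = 0
    · simp [hG, hz0]
    · have : z ∉ L.lattice := fun h ↦ hzL ⟨h, hz0⟩
      simp only [hG, this, if_false, hz hz0]
  have hGan (z : ℂ) : AnalyticAt ℂ G z := by
    by_cases hz : z ∈ L.lattice
    · have h0 : AnalyticAt ℂ G (z - z) := by rwa [sub_self]
      have : AnalyticAt ℂ (fun w ↦ G (w - z)) z :=
        AnalyticAt.comp (f := fun w ↦ w - z) h0 (by fun_prop)
      refine this.congr (.of_forall fun w ↦ ?_)
      simpa using (hGper (w - z) z hz).symm
    · have h1 := L.analyticOnNhd_weierstrassP z hz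
      have h2 : AnalyticAt ℂ (fun u ↦ σ (u + v) * σ (u - v)) z :=
        Differentiable.analyticAt (by fun_prop) z
      have h3 : AnalyticAt ℂ (fun u ↦ σ u ^ 2) z :=
        Differentiable.analyticAt (by fun_prop) z
      have h4 : AnalyticAt ℂ g z :=
        (h2.div h3 (pow_ne_zero 2 (weierstrassSigma_ne_zero L hz))).add (by fun_prop)
      refine h4.congr ?_
      filter_upwards [L.isClosed_lattice.isOpen_compl.mem_nhds hz] with w hw
      have : w ∉ L.lattice := hw
      simp [hG, this]
  have hGd : Differentiable ℂ G := fun z ↦ (hGan z).differentiableAt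
  have hconst := hGd.apply_eq_apply_of_bounded
    (IsZLattice.isCompact_range_of_periodic L.lattice _ hGd.continuous hGper).isBounded u v
  simp only [hG, hu, hv, if_false, hg] at hconst
  have hσ0 : σ 0 = 0 := weierstrassSigma_zero L
  have hσu : σ u ≠ 0 := weierstrassSigma_ne_zero L hu
  rw [sub_self, hσ0, mul_zero, zero_div, zero_add] at hconst
  field_simp at hconst
  linear_combination hconst

/-- The three-term relation for the sigma function. -/
theorem weierstrassSigma_three_term (z u v w : ℂ) :
    weierstrassSigma L (z + u) * weierstrassSigma L (z - u) *
        (weierstrassSigma L (v + w) * weierstrassSigma L (v - w)) +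
      weierstrassSigma L (z + v) * weierstrassSigma L (z - v) *
        (weierstrassSigma L (w + u) * weierstrassSigma L (w - u)) +
      weierstrassSigma L (z + w) * weierstrassSigma L (z - w) *
        (weierstrassSigma L (u + v) * weierstrassSigma L (u - v)) = 0 := by
  have hσ : Continuous (weierstrassSigma L) := (differentiable_weierstrassSigma L).continuous
  let D (z u : ℂ) : ℂ := weierstrassSigma L (z + u) * weierstrassSigma L (z - u)
  -- The addition formula needs all four variables off the lattice; density removes the exceptions
  -- one variable at a time.
  refine eq_zero_of_forall_notMem_lattice L
    (f := fun z ↦ D z u * D v w + D z v * D w u + D z w * D u v) (by fun_prop) fun z hz ↦ ?_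
  refine eq_zero_of_forall_notMem_lattice L
    (f := fun u ↦ D z u * D v w + D z v * D w u + D z w * D u v) (by fun_prop) fun u hu ↦ ?_
  refine eq_zero_of_forall_notMem_lattice L
    (f := fun v ↦ D z u * D v w + D z v * D w u + D z w * D u v) (by fun_prop) fun v hv ↦ ?_
  refine eq_zero_of_forall_notMem_lattice L
    (f := fun w ↦ D z u * D v w + D z v * D w u + D z w * D u v) (by fun_prop) fun w hw ↦ ?_
  simp only [D, weierstrassSigma_add_mul_sub L hz hu, weierstrassSigma_add_mul_sub L hz hv,
    weierstrassSigma_add_mul_sub L hz hw, weierstrassSigma_add_mul_sub L hv hw,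
    weierstrassSigma_add_mul_sub L hw hu, weierstrassSigma_add_mul_sub L hu hv]
  ring

variable (c : ℂ)

theorem continuous_bracket : Continuous (bracket L c) := by
  have hσ : Continuous (weierstrassSigma L) := (differentiable_weierstrassSigma L).continuous
  unfold bracket
  fun_prop

theorem bracket_neg (u : ℂ) : bracket L c (-u) = -bracket L c u := by
  simp [bracket, weierstrassSigma_neg]

theorem bracket_eq_zero_iff {u : ℂ} : bracket L c u = 0 ↔ u ∈ L.lattice := by
  simp [bracket, weierstrassSigma_eq_zero_iff, Complex.exp_ne_zero]

/-- The three-term relation for the elliptic bracket. -/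
theorem bracket_three_term (z u v w : ℂ) :
    bracket L c (z + u) * bracket L c (z - u) * (bracket L c (v + w) * bracket L c (v - w)) +
      bracket L c (z + v) * bracket L c (z - v) * (bracket L c (w + u) * bracket L c (w - u)) +
      bracket L c (z + w) * bracket L c (z - w) * (bracket L c (u + v) * bracket L c (u - v)) =
      0 := by
  -- As (z+u)² + (z-u)² = 2z² + 2u², each of the three products acquires the same Gaussian factor.
  have key (z u : ℂ) : bracket L c (z + u) * bracket L c (z - u) =
      Complex.exp (4 * (Real.pi : ℂ) * Complex.I * c * z ^ 2) *
        Complex.exp (4 * (Real.pi : ℂ) * Complex.I * c * u ^ 2) *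
        (weierstrassSigma L (z + u) * weierstrassSigma L (z - u)) := by
    simp only [bracket]
    rw [mul_mul_mul_comm, ← Complex.exp_add, ← Complex.exp_add]
    congr 2
    ring
  simp only [key]
  linear_combination (Complex.exp (4 * (Real.pi : ℂ) * Complex.I * c * z ^ 2) *
    Complex.exp (4 * (Real.pi : ℂ) * Complex.I * c * u ^ 2) *
    Complex.exp (4 * (Real.pi : ℂ) * Complex.I * c * v ^ 2) *
    Complex.exp (4 * (Real.pi : ℂ) * Complex.I * c * w ^ 2)) *
    weierstrassSigma_three_term L z u v w

end

/-! ### Theta brackets and elliptic partial fractions. -/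

/-- A function is a *theta bracket* if it is odd and satisfies the three-term relation. -/
structure IsThetaBracket (s : ℂ → ℂ) : Prop where
  neg : ∀ u, s (-u) = -s u
  three_term : ∀ z u v w, s (z + u) * s (z - u) * (s (v + w) * s (v - w)) +
    s (z + v) * s (z - v) * (s (w + u) * s (w - u)) +
    s (z + w) * s (z - w) * (s (u + v) * s (u - v)) = 0

theorem isThetaBracket_bracket (L : PeriodPair) (c : ℂ) : IsThetaBracket (bracket L c) :=
  ⟨bracket_neg L c, bracket_three_term L c⟩

namespace IsThetaBracket

variable {s : ℂ → ℂ} (hs : IsThetaBracket s)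

include hs

theorem zero : s 0 = 0 := by
  have := hs.neg 0
  rw [neg_zero] at this
  linear_combination this / 2

theorem sub_comm (u v : ℂ) : s (u - v) = -s (v - u) := by
  rw [← hs.neg, neg_sub]

/-- The product `[X+f][X+g]` as a combination of products vanishing at `x₁` and at `x₂`. -/
theorem mul_interpolate (X x₁ x₂ f g : ℂ) :
    s (X + f) * s (X + g) * (s (x₁ + x₂ + (f + g)) * s (x₁ - x₂)) =
      -(s (X + (x₁ + (f + g))) * s (X - x₁) * (s (x₂ + f) * s (x₂ + g))) +
        s (X + (x₂ + (f + g))) * s (X - x₂) * (s (x₁ + f) * s (x₁ + g)) := by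
  -- Translation by (f + g)/2 makes X + f and X + g symmetric about a centre, as the three-term
  -- relation requires.
  have h := hs.three_term (X + (f + g) / 2) ((f - g) / 2) (x₁ + (f + g) / 2) (x₂ + (f + g) / 2)
  rw [show X + (f + g) / 2 + (f - g) / 2 = X + f by ring,
    show X + (f + g) / 2 - (f - g) / 2 = X + g by ring,
    show x₁ + (f + g) / 2 + (x₂ + (f + g) / 2) = x₁ + x₂ + (f + g) by ring,
    show x₁ + (f + g) / 2 - (x₂ + (f + g) / 2) = x₁ - x₂ by ring,
    show X + (f + g) / 2 + (x₁ + (f + g) / 2) = X + (x₁ + (f + g)) by ring,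
    show X + (f + g) / 2 - (x₁ + (f + g) / 2) = X - x₁ by ring,
    show x₂ + (f + g) / 2 + (f - g) / 2 = x₂ + f by ring,
    show x₂ + (f + g) / 2 - (f - g) / 2 = x₂ + g by ring,
    show X + (f + g) / 2 + (x₂ + (f + g) / 2) = X + (x₂ + (f + g)) by ring,
    show X + (f + g) / 2 - (x₂ + (f + g) / 2) = X - x₂ by ring,
    show (f - g) / 2 + (x₁ + (f + g) / 2) = x₁ + f by ring,
    show (f - g) / 2 - (x₁ + (f + g) / 2) = -(x₁ + g) by ring, hs.neg] at h
  linear_combination h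

/-- Interpolation of s(X+f₁)s(X+f₂) from x₂, x₃, evaluated at X = x₁; balancing turns the extra
arguments into -(x_i + f₃). -/
theorem partial_fraction_three {x₁ x₂ x₃ f₁ f₂ f₃ : ℂ}
    (h : x₁ + x₂ + x₃ + (f₁ + f₂ + f₃) = 0)
    (h₁₂ : s (x₁ - x₂) ≠ 0) (h₁₃ : s (x₁ - x₃) ≠ 0) (h₂₃ : s (x₂ - x₃) ≠ 0) :
    s (x₁ + f₁) * s (x₁ + f₂) * s (x₁ + f₃) / (s (x₁ - x₂) * s (x₁ - x₃)) +
      s (x₂ + f₁) * s (x₂ + f₂) * s (x₂ + f₃) / (s (x₂ - x₁) * s (x₂ - x₃)) +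
      s (x₃ + f₁) * s (x₃ + f₂) * s (x₃ + f₃) / (s (x₃ - x₁) * s (x₃ - x₂)) = 0 := by
  have k := hs.mul_interpolate x₁ x₂ x₃ f₁ f₂
  rw [show x₂ + x₃ + (f₁ + f₂) = -(x₁ + f₃) by linear_combination h,
    show x₁ + (x₂ + (f₁ + f₂)) = -(x₃ + f₃) by linear_combination h,
    show x₁ + (x₃ + (f₁ + f₂)) = -(x₂ + f₃) by linear_combination h, hs.neg, hs.neg, hs.neg] at k
  rw [hs.sub_comm x₂ x₁, hs.sub_comm x₃ x₁, hs.sub_comm x₃ x₂]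
  field_simp
  linear_combination -k

omit hs in
-- Each interpolating product cancels one of the two denominators d₁, d₂, so a summand splits into
-- two summands with one pole fewer.
theorem mul_div_interpolate {D q r d₁ d₂ e P₁ P₂ q₁ q₂ : ℂ} (hd₁ : d₁ ≠ 0) (hd₂ : d₂ ≠ 0)
    (h : q * D = -(P₁ * d₁ * q₂) + P₂ * d₂ * q₁) :
    r * q / (d₁ * d₂ * e) * D = -(q₂ * (r * P₁ / (d₂ * e))) + q₁ * (r * P₂ / (d₁ * e)) := by
  rw [div_mul_eq_mul_div, mul_assoc, h]
  rcases eq_or_ne e 0 with rfl | he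
  · simp
  · field_simp

/-- Interpolating the pair f₃, f₄ from the nodes x₁, x₂ splits the sum into two three-node
identities, one omitting x₁ and one omitting x₂. The condition `hD` is the nonvanishing of the
interpolation determinant. -/
theorem partial_fraction_four {x₁ x₂ x₃ x₄ f₁ f₂ f₃ f₄ : ℂ}
    (h : x₁ + x₂ + x₃ + x₄ + (f₁ + f₂ + f₃ + f₄) = 0)
    (hD : s (x₁ + x₂ + (f₃ + f₄)) ≠ 0)
    (h₁₂ : s (x₁ - x₂) ≠ 0) (h₁₃ : s (x₁ - x₃) ≠ 0) (h₁₄ : s (x₁ - x₄) ≠ 0)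
    (h₂₃ : s (x₂ - x₃) ≠ 0) (h₂₄ : s (x₂ - x₄) ≠ 0) (h₃₄ : s (x₃ - x₄) ≠ 0) :
    s (x₁ + f₁) * s (x₁ + f₂) * (s (x₁ + f₃) * s (x₁ + f₄)) /
        (s (x₁ - x₂) * s (x₁ - x₃) * s (x₁ - x₄)) +
      s (x₂ + f₁) * s (x₂ + f₂) * (s (x₂ + f₃) * s (x₂ + f₄)) /
        (s (x₂ - x₁) * s (x₂ - x₃) * s (x₂ - x₄)) +
      s (x₃ + f₁) * s (x₃ + f₂) * (s (x₃ + f₃) * s (x₃ + f₄)) /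
        (s (x₃ - x₁) * s (x₃ - x₂) * s (x₃ - x₄)) +
      s (x₄ + f₁) * s (x₄ + f₂) * (s (x₄ + f₃) * s (x₄ + f₄)) /
        (s (x₄ - x₁) * s (x₄ - x₂) * s (x₄ - x₃)) = 0 := by
  have hA := hs.partial_fraction_three (x₁ := x₂) (x₂ := x₃) (x₃ := x₄) (f₁ := f₁) (f₂ := f₂)
    (f₃ := x₁ + (f₃ + f₄)) (by linear_combination h) h₂₃ h₂₄ h₃₄
  have hB := hs.partial_fraction_three (x₁ := x₁) (x₂ := x₃) (x₃ := x₄) (f₁ := f₁) (f₂ := f₂)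
    (f₃ := x₂ + (f₃ + f₄)) (by linear_combination h) h₁₃ h₁₄ h₃₄
  have n (a b : ℂ) (h : s (a - b) ≠ 0) : s (b - a) ≠ 0 := by rwa [hs.sub_comm, neg_ne_zero]
  have k₃ := mul_div_interpolate (r := s (x₃ + f₁) * s (x₃ + f₂)) (e := s (x₃ - x₄))
    (n _ _ h₁₃) (n _ _ h₂₃) (hs.mul_interpolate x₃ x₁ x₂ f₃ f₄)
  have k₄ := mul_div_interpolate (r := s (x₄ + f₁) * s (x₄ + f₂)) (e := s (x₄ - x₃))
    (n _ _ h₁₄) (n _ _ h₂₄) (hs.mul_interpolate x₄ x₁ x₂ f₃ f₄)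
  have k₁ : s (x₁ + f₁) * s (x₁ + f₂) * (s (x₁ + f₃) * s (x₁ + f₄)) /
        (s (x₁ - x₂) * s (x₁ - x₃) * s (x₁ - x₄)) *
          (s (x₁ + x₂ + (f₃ + f₄)) * s (x₁ - x₂)) =
      s (x₁ + f₃) * s (x₁ + f₄) * (s (x₁ + f₁) * s (x₁ + f₂) * s (x₁ + (x₂ + (f₃ + f₄))) /
        (s (x₁ - x₃) * s (x₁ - x₄))) := by
    rw [← add_assoc x₁ x₂]; field_simp
  have k₂ : s (x₂ + f₁) * s (x₂ + f₂) * (s (x₂ + f₃) * s (x₂ + f₄)) /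
        (s (x₂ - x₁) * s (x₂ - x₃) * s (x₂ - x₄)) *
          (s (x₁ + x₂ + (f₃ + f₄)) * s (x₁ - x₂)) =
      -(s (x₂ + f₃) * s (x₂ + f₄) * (s (x₂ + f₁) * s (x₂ + f₂) * s (x₂ + (x₁ + (f₃ + f₄))) /
        (s (x₂ - x₃) * s (x₂ - x₄)))) := by
    rw [← add_assoc x₂ x₁, hs.sub_comm x₂ x₁, add_comm x₂ x₁]; field_simp
  refine mul_right_cancel₀ (mul_ne_zero hD h₁₂) ?_
  rw [zero_mul, add_mul, add_mul, add_mul, k₁, k₂, k₃, k₄]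
  linear_combination -(s (x₂ + f₃) * s (x₂ + f₄)) * hA + s (x₁ + f₃) * s (x₁ + f₄) * hB

theorem partial_fraction_five {x₁ x₂ x₃ x₄ x₅ f₁ f₂ f₃ f₄ f₅ : ℂ}
    (h : x₁ + x₂ + x₃ + x₄ + x₅ + (f₁ + f₂ + f₃ + f₄ + f₅) = 0)
    (hD : s (x₁ + x₂ + (f₄ + f₅)) ≠ 0) (hD' : s (x₃ + x₄ + (f₂ + f₃)) ≠ 0)
    (h₁₂ : s (x₁ - x₂) ≠ 0) (h₁₃ : s (x₁ - x₃) ≠ 0) (h₁₄ : s (x₁ - x₄) ≠ 0)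
    (h₁₅ : s (x₁ - x₅) ≠ 0) (h₂₃ : s (x₂ - x₃) ≠ 0) (h₂₄ : s (x₂ - x₄) ≠ 0)
    (h₂₅ : s (x₂ - x₅) ≠ 0) (h₃₄ : s (x₃ - x₄) ≠ 0) (h₃₅ : s (x₃ - x₅) ≠ 0)
    (h₄₅ : s (x₄ - x₅) ≠ 0) :
    s (x₁ + f₁) * s (x₁ + f₂) * s (x₁ + f₃) * (s (x₁ + f₄) * s (x₁ + f₅)) /
        (s (x₁ - x₂) * s (x₁ - x₃) * (s (x₁ - x₄) * s (x₁ - x₅))) +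
      s (x₂ + f₁) * s (x₂ + f₂) * s (x₂ + f₃) * (s (x₂ + f₄) * s (x₂ + f₅)) /
        (s (x₂ - x₁) * s (x₂ - x₃) * (s (x₂ - x₄) * s (x₂ - x₅))) +
      s (x₃ + f₁) * s (x₃ + f₂) * s (x₃ + f₃) * (s (x₃ + f₄) * s (x₃ + f₅)) /
        (s (x₃ - x₁) * s (x₃ - x₂) * (s (x₃ - x₄) * s (x₃ - x₅))) +
      s (x₄ + f₁) * s (x₄ + f₂) * s (x₄ + f₃) * (s (x₄ + f₄) * s (x₄ + f₅)) /
        (s (x₄ - x₁) * s (x₄ - x₂) * (s (x₄ - x₃) * s (x₄ - x₅))) +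
      s (x₅ + f₁) * s (x₅ + f₂) * s (x₅ + f₃) * (s (x₅ + f₄) * s (x₅ + f₅)) /
        (s (x₅ - x₁) * s (x₅ - x₂) * (s (x₅ - x₃) * s (x₅ - x₄))) = 0 := by
  have n {a b : ℂ} (h : s (a - b) ≠ 0) : s (b - a) ≠ 0 := by rwa [hs.sub_comm, neg_ne_zero]
  -- The same reduction by one node. Listing x₃, x₄ first makes `hD'` the determinant condition of
  -- both smaller identities.
  have hA := hs.partial_fraction_four (x₁ := x₃) (x₂ := x₄) (x₃ := x₅) (x₄ := x₂)
    (f₁ := f₁) (f₂ := x₁ + (f₄ + f₅)) (f₃ := f₂) (f₄ := f₃)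
    (by linear_combination h) hD' h₃₄ h₃₅ (n h₂₃) h₄₅ (n h₂₄) (n h₂₅)
  have hB := hs.partial_fraction_four (x₁ := x₃) (x₂ := x₄) (x₃ := x₅) (x₄ := x₁)
    (f₁ := f₁) (f₂ := x₂ + (f₄ + f₅)) (f₃ := f₂) (f₄ := f₃)
    (by linear_combination h) hD' h₃₄ h₃₅ (n h₁₃) h₄₅ (n h₁₄) (n h₁₅)
  have k₃ := mul_div_interpolate (r := s (x₃ + f₁) * s (x₃ + f₂) * s (x₃ + f₃))
    (e := s (x₃ - x₄) * s (x₃ - x₅)) (n h₁₃) (n h₂₃) (hs.mul_interpolate x₃ x₁ x₂ f₄ f₅)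
  have k₄ := mul_div_interpolate (r := s (x₄ + f₁) * s (x₄ + f₂) * s (x₄ + f₃))
    (e := s (x₄ - x₃) * s (x₄ - x₅)) (n h₁₄) (n h₂₄) (hs.mul_interpolate x₄ x₁ x₂ f₄ f₅)
  have k₅ := mul_div_interpolate (r := s (x₅ + f₁) * s (x₅ + f₂) * s (x₅ + f₃))
    (e := s (x₅ - x₃) * s (x₅ - x₄)) (n h₁₅) (n h₂₅) (hs.mul_interpolate x₅ x₁ x₂ f₄ f₅)
  have k₁ : s (x₁ + f₁) * s (x₁ + f₂) * s (x₁ + f₃) * (s (x₁ + f₄) * s (x₁ + f₅)) /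
        (s (x₁ - x₂) * s (x₁ - x₃) * (s (x₁ - x₄) * s (x₁ - x₅))) *
          (s (x₁ + x₂ + (f₄ + f₅)) * s (x₁ - x₂)) =
      s (x₁ + f₄) * s (x₁ + f₅) * (s (x₁ + f₁) * s (x₁ + f₂) * s (x₁ + f₃) *
        s (x₁ + (x₂ + (f₄ + f₅))) / (s (x₁ - x₃) * (s (x₁ - x₄) * s (x₁ - x₅)))) := by
    rw [← add_assoc x₁ x₂]; field_simp
  have k₂ : s (x₂ + f₁) * s (x₂ + f₂) * s (x₂ + f₃) * (s (x₂ + f₄) * s (x₂ + f₅)) /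
        (s (x₂ - x₁) * s (x₂ - x₃) * (s (x₂ - x₄) * s (x₂ - x₅))) *
          (s (x₁ + x₂ + (f₄ + f₅)) * s (x₁ - x₂)) =
      -(s (x₂ + f₄) * s (x₂ + f₅) * (s (x₂ + f₁) * s (x₂ + f₂) * s (x₂ + f₃) *
        s (x₂ + (x₁ + (f₄ + f₅))) / (s (x₂ - x₃) * (s (x₂ - x₄) * s (x₂ - x₅))))) := by
    rw [← add_assoc x₂ x₁, hs.sub_comm x₂ x₁, add_comm x₂ x₁]; field_simp
  refine mul_right_cancel₀ (mul_ne_zero hD h₁₂) ?_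
  rw [zero_mul, add_mul, add_mul, add_mul, add_mul, k₁, k₂, k₃, k₄, k₅]
  linear_combination -(s (x₂ + f₄) * s (x₂ + f₅)) * hA + s (x₁ + f₄) * s (x₁ + f₅) * hB

/-- Partial fraction decomposition of an even function of `z` with poles at `±e₁, ±e₂, ±e₃`. -/
theorem partial_fraction_even {z e₁ e₂ e₃ f₁ f₂ f₃ f₄ f₅ : ℂ}
    (h : e₁ + e₂ + e₃ + (f₁ + f₂ + f₃ + f₄ + f₅) = 0)
    (hD : s (f₄ + f₅) ≠ 0) (hD' : s (e₁ + e₂ + (f₂ + f₃)) ≠ 0)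
    (hz : s (2 * z) ≠ 0) (h₁ : s (z - e₁) ≠ 0) (h₂ : s (z - e₂) ≠ 0) (h₃ : s (z - e₃) ≠ 0)
    (h₁' : s (z + e₁) ≠ 0) (h₂' : s (z + e₂) ≠ 0) (h₃' : s (z + e₃) ≠ 0)
    (h₁₂ : s (e₁ - e₂) ≠ 0) (h₁₃ : s (e₁ - e₃) ≠ 0) (h₂₃ : s (e₂ - e₃) ≠ 0) :
    s (z + f₁) * s (z + f₂) * s (z + f₃) * s (z + f₄) * s (z + f₅) /
        (s (2 * z) * s (z - e₁) * s (z - e₂) * s (z - e₃)) -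
      s (z - f₁) * s (z - f₂) * s (z - f₃) * s (z - f₄) * s (z - f₅) /
        (s (2 * z) * s (z + e₁) * s (z + e₂) * s (z + e₃)) =
    s (e₁ + f₁) * s (e₁ + f₂) * s (e₁ + f₃) * s (e₁ + f₄) * s (e₁ + f₅) /
        (s (e₁ - e₂) * s (e₁ - e₃)) / (s (z + e₁) * s (z - e₁)) +
      s (e₂ + f₁) * s (e₂ + f₂) * s (e₂ + f₃) * s (e₂ + f₄) * s (e₂ + f₅) /
        (s (e₂ - e₁) * s (e₂ - e₃)) / (s (z + e₂) * s (z - e₂)) +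
      s (e₃ + f₁) * s (e₃ + f₂) * s (e₃ + f₃) * s (e₃ + f₄) * s (e₃ + f₅) /
        (s (e₃ - e₁) * s (e₃ - e₂)) / (s (z + e₃) * s (z - e₃)) := by
  have hn (e : ℂ) : s (-z - e) = -s (z + e) := by rw [← hs.neg]; ring_nf
  have hn' (e : ℂ) : s (-z + e) = -s (z - e) := by rw [← hs.neg]; ring_nf
  have hp (e : ℂ) : s (e - -z) = s (z + e) := by rw [sub_neg_eq_add, add_comm]
  have hzz : s (z - -z) = s (2 * z) := by ring_nf
  have hzz' : s (-z - z) = -s (2 * z) := by rw [← hs.neg]; ring_nf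
  -- With ±z among the nodes, their residues form the left side and z cancels from the balancing
  -- condition.
  have := hs.partial_fraction_five (x₁ := z) (x₂ := -z) (x₃ := e₁) (x₄ := e₂) (x₅ := e₃)
    (f₁ := f₁) (f₂ := f₂) (f₃ := f₃) (f₄ := f₄) (f₅ := f₅) (by linear_combination h)
    (by simpa using hD) hD' (by rwa [hzz]) h₁ h₂ h₃ (by rwa [hn, neg_ne_zero])
    (by rwa [hn, neg_ne_zero]) (by rwa [hn, neg_ne_zero]) h₁₂ h₁₃ h₂₃
  rw [hzz, hzz'] at this
  simp only [hn, hn', hp] at this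
  rw [hs.sub_comm e₁ z, hs.sub_comm e₂ z, hs.sub_comm e₃ z] at this
  simp only [neg_mul, mul_neg, neg_neg, div_neg] at this
  linear_combination this

end IsThetaBracket

/-! ### Shifted products, the cleared sum, and its recurrence in the kernel degree. -/

noncomputable section

/-- The shifted factorial `s(u) s(u+δ) ⋯ s(u+(k-1)δ)` of an arbitrary function `s`. -/
def shiftedProd (s : ℂ → ℂ) (δ u : ℂ) (k : ℕ) : ℂ := ∏ j ∈ Finset.range k, s (u + (j : ℂ) * δ)

section shiftedProd

variable (s : ℂ → ℂ) (δ u : ℂ) (k m : ℕ)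

@[simp] theorem shiftedProd_zero : shiftedProd s δ u 0 = 1 := by simp [shiftedProd]

theorem shiftedProd_succ :
    shiftedProd s δ u (k + 1) = shiftedProd s δ u k * s (u + k * δ) := by
  simp [shiftedProd, Finset.prod_range_succ]

theorem shiftedProd_add :
    shiftedProd s δ u (k + m) = shiftedProd s δ u k * shiftedProd s δ (u + k * δ) m := by
  rw [shiftedProd, Finset.prod_range_add]
  congr 1
  refine Finset.prod_congr rfl fun j _ ↦ ?_
  push_cast
  ring_nf

theorem shiftedProd_succ' :
    shiftedProd s δ u (k + 1) = s u * shiftedProd s δ (u + δ) k := by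
  rw [add_comm, shiftedProd_add]
  simp [shiftedProd]

theorem mul_shiftedProd_add :
    s u * shiftedProd s δ (u + δ) k = shiftedProd s δ u k * s (u + k * δ) := by
  rw [← shiftedProd_succ, shiftedProd_succ']

variable {s} in
theorem shiftedProd_neg (hs : ∀ u, s (-u) = -s u) :
    shiftedProd s δ (-u) k = (-1) ^ k * shiftedProd s δ (u + δ - k * δ) k := by
  induction k generalizing u with
  | zero => simp
  | succ k ih =>
    rw [shiftedProd_succ, ih, shiftedProd_succ',
      show -u + (k : ℂ) * δ = -(u + δ - ((k + 1 : ℕ) : ℂ) * δ) by push_cast; ring, hs,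
      show u + δ - ((k + 1 : ℕ) : ℂ) * δ + δ = u + δ - k * δ by push_cast; ring]
    ring

variable {s δ u k} in
theorem shiftedProd_ne_zero_of_le (h : shiftedProd s δ u k ≠ 0) (hm : m ≤ k) :
    shiftedProd s δ u m ≠ 0 := by
  obtain ⟨n, rfl⟩ := Nat.exists_eq_add_of_le hm
  rw [shiftedProd_add] at h
  exact left_ne_zero_of_mul h

end shiftedProd

/-- The elementary coefficient of the very well-poised sum. -/
def wpCoeff (s : ℂ → ℂ) (δ x : ℂ) (M k : ℕ) : ℂ :=
  (-1) ^ k * s (2 * (x + k * δ)) * shiftedProd s δ δ M /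
    (shiftedProd s δ δ k * shiftedProd s δ δ (M - k) * shiftedProd s δ (2 * x + k * δ) (M + 1))

/-- The contribution of one parameter `a` to the very well-poised sum. -/
def wpParam (s : ℂ → ℂ) (δ x a : ℂ) (M k : ℕ) : ℂ :=
  shiftedProd s δ (x + δ / 2 - a) k * shiftedProd s δ (x + δ / 2 + a + k * δ) (M - k)

/-- The product `∏_{j < N} s(z + y + δ/2 + jδ) s(z - y - δ/2 - jδ)`. -/
def wpKernel (s : ℂ → ℂ) (δ z y : ℂ) (N : ℕ) : ℂ :=
  shiftedProd s δ (z + y + δ / 2) N * shiftedProd s δ (z - y + δ / 2 - N * δ) N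

/-- A term of the very well-poised sum, cleared of all denominators that depend on the
parameters `a₀, …, a₃` and on `y`. -/
def wpTerm (s : ℂ → ℂ) (δ : ℂ) (M N : ℕ) (x y a₀ a₁ a₂ a₃ : ℂ) (k : ℕ) : ℂ :=
  wpCoeff s δ x M k * (wpParam s δ x a₀ M k * wpParam s δ x a₁ M k * wpParam s δ x a₂ M k *
    wpParam s δ x a₃ M k) * wpKernel s δ (x + k * δ) y N

/-- The very well-poised sum with cleared denominators. -/
def wpSum (s : ℂ → ℂ) (δ : ℂ) (M N : ℕ) (x y a₀ a₁ a₂ a₃ : ℂ) : ℂ :=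
  ∑ k ∈ Finset.range (M + 1), wpTerm s δ M N x y a₀ a₁ a₂ a₃ k

section

variable (s : ℂ → ℂ) (δ : ℂ)

theorem wpSum_swap₀₁ (M N : ℕ) (x y a₀ a₁ a₂ a₃ : ℂ) :
    wpSum s δ M N x y a₀ a₁ a₂ a₃ = wpSum s δ M N x y a₁ a₀ a₂ a₃ := by
  refine Finset.sum_congr rfl fun k _ ↦ ?_
  simp only [wpTerm]
  ring

theorem wpKernel_succ (z y : ℂ) (N : ℕ) :
    wpKernel s δ z y (N + 1) =
      wpKernel s δ z y N * (s (z + (y + δ / 2 + N * δ)) * s (z - (y + δ / 2 + N * δ))) := by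
  simp only [wpKernel]
  rw [shiftedProd_succ, shiftedProd_succ',
    show z - y + δ / 2 - ((N + 1 : ℕ) : ℂ) * δ = z - (y + δ / 2 + N * δ) by push_cast; ring,
    show z - (y + δ / 2 + N * δ) + δ = z - y + δ / 2 - N * δ by ring,
    show z + y + δ / 2 + N * δ = z + (y + δ / 2 + N * δ) by ring]
  ring

/-- The even factor in z = x + kδ attached to a is absorbed by lowering a by δ, at the cost of a
constant independent of k. -/
theorem wpParam_mul (x a : ℂ) {M k : ℕ} (hk : k ≤ M) :
    wpParam s δ x a M k * (s (x + k * δ + (δ / 2 - a)) * s (x + k * δ - (δ / 2 - a))) =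
      s (x + δ / 2 - a) * s (x + M * δ - δ / 2 + a) * wpParam s δ x (a - δ) M k := by
  obtain ⟨m, rfl⟩ := Nat.exists_eq_add_of_le hk
  simp only [wpParam, Nat.add_sub_cancel_left]
  have h₁ := mul_shiftedProd_add s δ (x + δ / 2 - a) k
  have h₂ := mul_shiftedProd_add s δ (x + δ / 2 + (a - δ) + k * δ) m
  rw [show x + δ / 2 + (a - δ) + k * δ + δ = x + δ / 2 + a + k * δ by ring] at h₂
  rw [show x + k * δ + (δ / 2 - a) = x + δ / 2 - a + k * δ by ring,
    show x + k * δ - (δ / 2 - a) = x + δ / 2 + (a - δ) + k * δ by ring,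
    show x + ((k + m : ℕ) : ℂ) * δ - δ / 2 + a = x + δ / 2 + (a - δ) + k * δ + m * δ by
      push_cast; ring,
    show x + δ / 2 - (a - δ) = x + δ / 2 - a + δ by ring]
  linear_combination s (x + δ / 2 + (a - δ) + k * δ) *
    shiftedProd s δ (x + δ / 2 + a + k * δ) m * (-h₁) +
    s (x + δ / 2 - a) * shiftedProd s δ (x + δ / 2 - a + δ) k * h₂

variable {s} in
/-- Three-term recurrence of the sum in the degree `N` of its kernel. -/
theorem wpSum_succ_right (hs : IsThetaBracket s) (M N : ℕ) (x y a₀ a₁ a₂ a₃ : ℂ) :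
    s (δ - a₀ - a₁) * s (a₁ - a₀) * wpSum s δ M (N + 1) x y a₀ a₁ a₂ a₃ =
      s (y + (N + 1) * δ - a₁) * s (y + (N + 1) * δ + a₁ - δ) *
          (s (x + δ / 2 - a₀) * s (x + M * δ - δ / 2 + a₀)) *
          wpSum s δ M N x y (a₀ - δ) a₁ a₂ a₃ -
        s (y + (N + 1) * δ - a₀) * s (y + (N + 1) * δ + a₀ - δ) *
          (s (x + δ / 2 - a₁) * s (x + M * δ - δ / 2 + a₁)) *
          wpSum s δ M N x y a₀ (a₁ - δ) a₂ a₃ := by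
  simp only [wpSum, Finset.mul_sum, ← Finset.sum_sub_distrib]
  refine Finset.sum_congr rfl fun k hk ↦ ?_
  have hk : k ≤ M := Nat.lt_succ_iff.1 (Finset.mem_range.1 hk)
  have h₀ := wpParam_mul s δ x a₀ hk
  have h₁ := wpParam_mul s δ x a₁ hk
  -- The new kernel factor is expanded in the even factors attached to a₀ and a₁; the coefficients
  -- do not depend on k.
  have h := hs.three_term (x + k * δ) (y + δ / 2 + N * δ) (δ / 2 - a₀) (δ / 2 - a₁)
  rw [show δ / 2 - a₀ + (δ / 2 - a₁) = δ - a₀ - a₁ by ring,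
    show δ / 2 - a₀ - (δ / 2 - a₁) = a₁ - a₀ by ring,
    show δ / 2 - a₁ + (y + δ / 2 + N * δ) = y + (N + 1) * δ - a₁ by ring,
    show δ / 2 - a₁ - (y + δ / 2 + N * δ) = -(y + (N + 1) * δ + a₁ - δ) by ring,
    show y + δ / 2 + N * δ + (δ / 2 - a₀) = y + (N + 1) * δ - a₀ by ring,
    show y + δ / 2 + N * δ - (δ / 2 - a₀) = y + (N + 1) * δ + a₀ - δ by ring, hs.neg] at h
  simp only [wpTerm, wpKernel_succ]
  linear_combination wpCoeff s δ x M k * wpKernel s δ (x + k * δ) y N * wpParam s δ x a₂ M k *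
      wpParam s δ x a₃ M k * (wpParam s δ x a₀ M k * wpParam s δ x a₁ M k * h +
      s (y + (N + 1) * δ - a₁) * s (y + (N + 1) * δ + a₁ - δ) * wpParam s δ x a₁ M k * h₀ -
      s (y + (N + 1) * δ - a₀) * s (y + (N + 1) * δ + a₀ - δ) * wpParam s δ x a₀ M k * h₁)

end

end

/-! ### Genericity conditions, stable under shifts by δ and under duality. -/

/-- The function `s` has no zero on the progression `u + ℤδ`. -/
def NonvanishingOn (s : ℂ → ℂ) (δ u : ℂ) : Prop := ∀ n : ℤ, s (u + n * δ) ≠ 0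

section NonvanishingOn

variable {s : ℂ → ℂ} {δ u v : ℂ}

theorem NonvanishingOn.ne (h : NonvanishingOn s δ u) (n : ℤ) (hv : v = u + n * δ) : s v ≠ 0 :=
  hv ▸ h n

theorem NonvanishingOn.shift (h : NonvanishingOn s δ u) (n : ℤ) (hv : v = u + n * δ) :
    NonvanishingOn s δ v := fun m ↦ h.ne (n + m) (by rw [hv]; push_cast; ring)

theorem NonvanishingOn.reflect (h : NonvanishingOn s δ u) (hs : ∀ u, s (-u) = -s u) (n : ℤ)
    (hv : v = -u + n * δ) : NonvanishingOn s δ v := fun m ↦ by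
  have := h (-(n + m))
  rw [← neg_ne_zero, ← hs] at this
  rw [hv]
  convert this using 2
  push_cast
  ring

theorem NonvanishingOn.shiftedProd_ne_zero (h : NonvanishingOn s δ u) (n : ℤ)
    (hv : v = u + n * δ) (k : ℕ) : shiftedProd s δ v k ≠ 0 :=
  Finset.prod_ne_zero_iff.2 fun j _ ↦ h.ne (n + j) (by rw [hv]; push_cast; ring)

end NonvanishingOn

/-- Genericity of a parameter `a` with respect to the variables `x` and `y`. -/
structure GenericParam (s : ℂ → ℂ) (δ x y a : ℂ) : Prop where
  x_add : NonvanishingOn s δ (x + δ / 2 + a)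
  x_sub : NonvanishingOn s δ (x + δ / 2 - a)
  y_add : NonvanishingOn s δ (y + a)
  y_sub : NonvanishingOn s δ (y - a)

/-- Genericity of all variables and parameters. -/
structure Generic (s : ℂ → ℂ) (δ x y a₀ a₁ a₂ a₃ : ℂ) : Prop where
  base : ∀ n : ℕ, s (δ + n * δ) ≠ 0
  two_x : NonvanishingOn s δ (2 * x)
  two_y : NonvanishingOn s δ (2 * y)
  add_xy : NonvanishingOn s δ (x + y + δ / 2)
  sub_xy : NonvanishingOn s δ (y - x + δ / 2)
  param₀ : GenericParam s δ x y a₀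
  param₁ : GenericParam s δ x y a₁
  param₂ : GenericParam s δ x y a₂
  param₃ : GenericParam s δ x y a₃
  sub₀₁ : NonvanishingOn s δ (a₀ - a₁)
  add₀₁ : NonvanishingOn s δ (a₀ + a₁)
  add₀₂ : NonvanishingOn s δ (a₀ + a₂)
  add₀₃ : NonvanishingOn s δ (a₀ + a₃)
  add₂₃ : NonvanishingOn s δ (a₂ + a₃)

section generic

variable {s : ℂ → ℂ} {δ x y a a₀ a₁ a₂ a₃ : ℂ}

theorem GenericParam.shift (h : GenericParam s δ x y a) : GenericParam s δ x y (a - δ) where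
  x_add := h.x_add.shift (-1) (by push_cast; ring)
  x_sub := h.x_sub.shift 1 (by push_cast; ring)
  y_add := h.y_add.shift (-1) (by push_cast; ring)
  y_sub := h.y_sub.shift 1 (by push_cast; ring)

theorem GenericParam.symm (h : GenericParam s δ x y a) :
    GenericParam s δ y x (δ / 2 - a) where
  x_add := h.y_sub.shift 1 (by push_cast; ring)
  x_sub := h.y_add.shift 0 (by push_cast; ring)
  y_add := h.x_sub.shift 0 (by push_cast; ring)
  y_sub := h.x_add.shift (-1) (by push_cast; ring)

namespace Generic

/-- Conditions on whole progressions survive shifts by δ, so the induction hypothesis applies to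
shifted parameters. -/
theorem shift₀ (h : Generic s δ x y a₀ a₁ a₂ a₃) : Generic s δ x y (a₀ - δ) a₁ a₂ a₃ :=
  { h with
    param₀ := h.param₀.shift
    sub₀₁ := h.sub₀₁.shift (-1) (by push_cast; ring)
    add₀₁ := h.add₀₁.shift (-1) (by push_cast; ring)
    add₀₂ := h.add₀₂.shift (-1) (by push_cast; ring)
    add₀₃ := h.add₀₃.shift (-1) (by push_cast; ring) }

theorem shift₁ (h : Generic s δ x y a₀ a₁ a₂ a₃) : Generic s δ x y a₀ (a₁ - δ) a₂ a₃ :=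
  { h with
    param₁ := h.param₁.shift
    sub₀₁ := h.sub₀₁.shift 1 (by push_cast; ring)
    add₀₁ := h.add₀₁.shift (-1) (by push_cast; ring) }

theorem symm (h : Generic s δ x y a₀ a₁ a₂ a₃) (hs : ∀ u, s (-u) = -s u) :
    Generic s δ y x (δ / 2 - a₀) (δ / 2 - a₁) (δ / 2 - a₂) (δ / 2 - a₃) where
  base := h.base
  two_x := h.two_y
  two_y := h.two_x
  add_xy := h.add_xy.shift 0 (by push_cast; ring)
  sub_xy := h.sub_xy.reflect hs 1 (by push_cast; ring)
  param₀ := h.param₀.symm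
  param₁ := h.param₁.symm
  param₂ := h.param₂.symm
  param₃ := h.param₃.symm
  sub₀₁ := h.sub₀₁.reflect hs 0 (by push_cast; ring)
  add₀₁ := h.add₀₁.reflect hs 1 (by push_cast; ring)
  add₀₂ := h.add₀₂.reflect hs 1 (by push_cast; ring)
  add₀₃ := h.add₀₃.reflect hs 1 (by push_cast; ring)
  add₂₃ := h.add₂₃.reflect hs 1 (by push_cast; ring)

theorem shiftedProd_base_ne_zero (h : Generic s δ x y a₀ a₁ a₂ a₃) (k : ℕ) :
    shiftedProd s δ δ k ≠ 0 :=
  Finset.prod_ne_zero_iff.2 fun j _ ↦ h.base j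

end Generic

end generic

/-! ### The recurrence of the dual sum in its length. -/

section

variable (s : ℂ → ℂ) (δ : ℂ)

theorem wpParam_reflect (y a : ℂ) (N l : ℕ) :
    wpParam s δ y (δ / 2 - a) N l =
      shiftedProd s δ (y + a) l * shiftedProd s δ (y + δ - a + l * δ) (N - l) := by
  simp only [wpParam]
  congr 2 <;> ring

theorem wpParam_reflect_shift (y a : ℂ) {N l : ℕ} (hl : l ≤ N) :
    wpParam s δ y (δ / 2 - (a - δ)) N l *
        (s (y + l * δ + (a - δ)) * s (y + l * δ - (a - δ))) =
      s (y + a - δ) * wpParam s δ y (δ / 2 - a) (N + 1) l := by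
  obtain ⟨m, rfl⟩ := Nat.exists_eq_add_of_le hl
  simp only [wpParam_reflect, Nat.add_sub_cancel_left, add_assoc l m 1]
  have h₁ := mul_shiftedProd_add s δ (y + (a - δ)) l
  rw [shiftedProd_succ', show y + δ - a + l * δ + δ = y + δ - (a - δ) + l * δ by ring]
  rw [show y + (a - δ) + δ = y + a by ring] at h₁
  rw [show y + l * δ + (a - δ) = y + (a - δ) + l * δ by ring,
    show y + l * δ - (a - δ) = y + δ - a + l * δ by ring,
    show y + a - δ = y + (a - δ) by ring]
  linear_combination -(shiftedProd s δ (y + δ - (a - δ) + l * δ) m * s (y + δ - a + l * δ)) * h₁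

theorem wpParam_reflect_succ (y a : ℂ) {N l : ℕ} (hl : l ≤ N) :
    wpParam s δ y (δ / 2 - a) (N + 1) l =
      wpParam s δ y (δ / 2 - a) N l * s (y + (N + 1) * δ - a) := by
  obtain ⟨m, rfl⟩ := Nat.exists_eq_add_of_le hl
  simp only [wpParam_reflect, Nat.add_sub_cancel_left, add_assoc l m 1]
  rw [shiftedProd_succ, show y + (((l + m : ℕ) : ℂ) + 1) * δ - a =
    y + δ - a + l * δ + m * δ by push_cast; ring]
  ring

theorem wpParam_reflect_step (y a : ℂ) {n l : ℕ} (hl : l < n) :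
    wpParam s δ y (δ / 2 - a) n (l + 1) * s (y + l * δ + δ - a) =
      wpParam s δ y (δ / 2 - a) n l * s (y + l * δ + a) := by
  obtain ⟨m, rfl⟩ := Nat.exists_eq_add_of_lt hl
  simp only [wpParam_reflect]
  rw [show l + m + 1 - (l + 1) = m by omega, show l + m + 1 - l = m + 1 by omega,
    shiftedProd_succ, shiftedProd_succ',
    show y + δ - a + l * δ + δ = y + δ - a + ((l + 1 : ℕ) : ℂ) * δ by push_cast; ring,
    show y + l * δ + δ - a = y + δ - a + l * δ by ring,
    show y + l * δ + a = y + a + l * δ by ring]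
  ring

theorem wpKernel_step (z x : ℂ) (M : ℕ) :
    wpKernel s δ (z + δ) x M * (s (z + (x + δ / 2)) * s (z + (δ / 2 - x - M * δ))) =
      wpKernel s δ z x M * (s (z + (x + δ / 2 + M * δ)) * s (z + (δ / 2 - x))) := by
  have h₁ := mul_shiftedProd_add s δ (z + x + δ / 2) M
  have h₂ := mul_shiftedProd_add s δ (z - x + δ / 2 - M * δ) M
  simp only [wpKernel]
  rw [show z + δ + x + δ / 2 = z + x + δ / 2 + δ by ring,
    show z + δ - x + δ / 2 - M * δ = z - x + δ / 2 - M * δ + δ by ring,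
    show z + (x + δ / 2) = z + x + δ / 2 by ring,
    show z + (δ / 2 - x - M * δ) = z - x + δ / 2 - M * δ by ring,
    show z + (x + δ / 2 + M * δ) = z + x + δ / 2 + M * δ by ring,
    show z + (δ / 2 - x) = z - x + δ / 2 - M * δ + M * δ by ring]
  linear_combination s (z - x + δ / 2 - M * δ) *
    shiftedProd s δ (z - x + δ / 2 - M * δ + δ) M * h₁ +
    shiftedProd s δ (z + x + δ / 2) M * s (z + x + δ / 2 + M * δ) * h₂

variable {s δ} {x y a₀ a₁ a₂ a₃ : ℂ} (hs : IsThetaBracket s)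
  (hg : Generic s δ x y a₀ a₁ a₂ a₃)

include hg

/-- The factor comparing lengths N and N + 1 is even in z = y + lδ, with zeros at z = ±(y + (N+1)δ):
this is the third pair of poles in the partial fractions. -/
theorem wpCoeff_succ {N l : ℕ} (hl : l ≤ N) :
    wpCoeff s δ y N l * s ((N + 1) * δ) = wpCoeff s δ y (N + 1) l *
      (s (y + (N + 1) * δ + (y + l * δ)) * s (y + (N + 1) * δ - (y + l * δ))) := by
  obtain ⟨m, rfl⟩ := Nat.exists_eq_add_of_le hl
  simp only [wpCoeff, Nat.add_sub_cancel_left, add_assoc l m 1]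
  have h₁ := hg.shiftedProd_base_ne_zero l
  have h₂ := hg.shiftedProd_base_ne_zero m
  have h₃ := hg.base m
  have h₄ := hg.two_y.shiftedProd_ne_zero l (v := 2 * y + l * δ) (by push_cast; ring) (l + (m + 1))
  have h₅ : s (2 * y + l * δ + (l + m + 1) * δ) ≠ 0 :=
    hg.two_y.ne (l + (l + m + 1)) (by push_cast; ring)
  rw [← add_assoc l m 1, shiftedProd_succ s δ δ m, shiftedProd_succ s δ δ (l + m),
    shiftedProd_succ s δ (2 * y + l * δ) (l + m + 1),
    show (((l + m : ℕ) : ℂ) + 1) * δ = δ + ((l + m : ℕ) : ℂ) * δ by push_cast; ring,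
    show y + (δ + ((l + m : ℕ) : ℂ) * δ) + (y + l * δ) = 2 * y + l * δ + (l + m + 1) * δ by
      push_cast; ring,
    show y + (δ + ((l + m : ℕ) : ℂ) * δ) - (y + l * δ) = δ + m * δ by push_cast; ring,
    show 2 * y + l * δ + ((l + m + 1 : ℕ) : ℂ) * δ = 2 * y + l * δ + (l + m + 1) * δ by
      push_cast; ring]
  rw [← add_assoc l m 1] at h₄
  generalize s (δ + m * δ) = X₁ at *
  generalize s (2 * y + l * δ + (l + m + 1) * δ) = X₂ at *
  generalize s (δ + ((l + m : ℕ) : ℂ) * δ) = X₃ at *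
  field_simp

include hs

theorem wpCoeff_step {n l : ℕ} (hl : l < n) :
    wpCoeff s δ y n (l + 1) * (s (2 * (y + l * δ)) * s (y + l * δ + δ - y) *
        s (y + l * δ + δ + (y + n * δ))) =
      wpCoeff s δ y n l * (s (2 * (y + l * δ + δ)) * s (y + l * δ + y) *
        s (y + l * δ - (y + n * δ))) := by
  obtain ⟨m, rfl⟩ := Nat.exists_eq_add_of_lt hl
  simp only [wpCoeff]
  have h₁ := hg.shiftedProd_base_ne_zero l
  have h₂ := hg.shiftedProd_base_ne_zero m
  have h₃ := hg.base m
  have h₄ := hg.base l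
  have h₅ := hg.two_y.shiftedProd_ne_zero l (v := 2 * y + l * δ) (by push_cast; ring)
    (l + m + 1 + 1)
  have h₆ := hg.two_y.shiftedProd_ne_zero (l + 1) (v := 2 * y + l * δ + δ) (by push_cast; ring)
    (l + m + 1 + 1)
  have h₇ := mul_shiftedProd_add s δ (2 * y + l * δ) (l + m + 1 + 1)
  rw [show l + m + 1 - (l + 1) = m by omega, show l + m + 1 - l = m + 1 by omega,
    shiftedProd_succ s δ δ m, shiftedProd_succ s δ δ l,
    show 2 * y + ((l + 1 : ℕ) : ℂ) * δ = 2 * y + l * δ + δ by push_cast; ring,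
    show y + ((l + 1 : ℕ) : ℂ) * δ = y + l * δ + δ by push_cast; ring,
    show y + l * δ + δ - y = δ + l * δ by ring,
    show y + l * δ + δ + (y + ((l + m + 1 : ℕ) : ℂ) * δ) =
      2 * y + l * δ + ((l + m + 1 + 1 : ℕ) : ℂ) * δ by push_cast; ring,
    show y + l * δ + y = 2 * y + l * δ by ring,
    show y + l * δ - (y + ((l + m + 1 : ℕ) : ℂ) * δ) = -(δ + m * δ) by push_cast; ring, hs.neg]
  generalize s (δ + m * δ) = X₁ at *
  generalize s (δ + l * δ) = X₂ at *
  generalize s (2 * (y + l * δ)) = X₃ at *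
  generalize s (2 * (y + l * δ + δ)) = X₄ at *
  generalize s (2 * y + l * δ + ((l + m + 1 + 1 : ℕ) : ℂ) * δ) = X₅ at *
  generalize s (2 * y + l * δ) = X₆ at *
  rw [pow_succ]
  field_simp
  linear_combination X₄ * shiftedProd s δ δ (l + m + 1) * X₃ * h₇

end

section

variable {s : ℂ → ℂ} {δ x y a₀ a₁ a₂ a₃ : ℂ} (hs : IsThetaBracket s)
  (hg : Generic s δ x y a₀ a₁ a₂ a₃)

include hs hg

/-- The consecutive terms of the dual sum, in the form needed for telescoping. -/
theorem wpTerm_telescope {n M l : ℕ} (hl : l < n) :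
    wpTerm s δ n M y x (δ / 2 - a₀) (δ / 2 - a₁) (δ / 2 - a₂) (δ / 2 - a₃) (l + 1) *
        (s (y + l * δ + δ - y) * s (y + l * δ + δ - (x + δ / 2 + M * δ)) *
          s (y + l * δ + δ - (δ / 2 - x)) * s (y + l * δ + δ - a₂) * s (y + l * δ + δ - a₃) *
          s (y + l * δ + δ - (-y - n * δ))) /
        (s (2 * (y + l * δ + δ)) * s (y + l * δ + δ + (a₀ - δ)) *
          s (y + l * δ + δ + (a₁ - δ))) =
      wpTerm s δ n M y x (δ / 2 - a₀) (δ / 2 - a₁) (δ / 2 - a₂) (δ / 2 - a₃) l *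
        (s (y + l * δ + y) * s (y + l * δ + (x + δ / 2 + M * δ)) *
          s (y + l * δ + (δ / 2 - x)) * s (y + l * δ + a₂) * s (y + l * δ + a₃) *
          s (y + l * δ + (-y - n * δ))) /
        (s (2 * (y + l * δ)) * s (y + l * δ - (a₀ - δ)) * s (y + l * δ - (a₁ - δ))) := by
  have hC := wpCoeff_step hs hg hl
  have h₀ := wpParam_reflect_step s δ y a₀ hl
  have h₁ := wpParam_reflect_step s δ y a₁ hl
  have h₂ := wpParam_reflect_step s δ y a₂ hl
  have h₃ := wpParam_reflect_step s δ y a₃ hl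
  have hK := wpKernel_step s δ (y + l * δ) x M
  simp only [wpTerm]
  rw [show y + ((l + 1 : ℕ) : ℂ) * δ = y + l * δ + δ by push_cast; ring,
    show y + l * δ + δ - (x + δ / 2 + M * δ) = y + l * δ + (δ / 2 - x - M * δ) by ring,
    show y + l * δ + δ - (δ / 2 - x) = y + l * δ + (x + δ / 2) by ring,
    show y + l * δ + δ - (-y - n * δ) = y + l * δ + δ + (y + n * δ) by ring,
    show y + l * δ + (-y - n * δ) = y + l * δ - (y + n * δ) by ring,
    show y + l * δ + δ + (a₀ - δ) = y + l * δ + a₀ by ring,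
    show y + l * δ + δ + (a₁ - δ) = y + l * δ + a₁ by ring,
    show y + l * δ - (a₀ - δ) = y + l * δ + δ - a₀ by ring,
    show y + l * δ - (a₁ - δ) = y + l * δ + δ - a₁ by ring]
  have n₁ : s (2 * (y + l * δ)) ≠ 0 := hg.two_y.ne (2 * l) (by push_cast; ring)
  have n₂ : s (2 * (y + l * δ + δ)) ≠ 0 := hg.two_y.ne (2 * l + 2) (by push_cast; ring)
  have p₀ : s (y + l * δ + a₀) ≠ 0 := hg.param₀.y_add.ne l (by push_cast; ring)
  have p₁ : s (y + l * δ + a₁) ≠ 0 := hg.param₁.y_add.ne l (by push_cast; ring)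
  have q₀ : s (y + l * δ + δ - a₀) ≠ 0 := hg.param₀.y_sub.ne (l + 1) (by push_cast; ring)
  have q₁ : s (y + l * δ + δ - a₁) ≠ 0 := hg.param₁.y_sub.ne (l + 1) (by push_cast; ring)
  rw [div_eq_div_iff (by simp [n₂, p₀, p₁]) (by simp [n₁, q₀, q₁])]
  generalize wpCoeff s δ y n (l + 1) = C' at *
  generalize wpCoeff s δ y n l = C at *
  generalize wpParam s δ y (δ / 2 - a₀) n (l + 1) = A₀' at *
  generalize wpParam s δ y (δ / 2 - a₁) n (l + 1) = A₁' at *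
  generalize wpParam s δ y (δ / 2 - a₂) n (l + 1) = A₂' at *
  generalize wpParam s δ y (δ / 2 - a₃) n (l + 1) = A₃' at *
  generalize wpParam s δ y (δ / 2 - a₀) n l = A₀ at *
  generalize wpParam s δ y (δ / 2 - a₁) n l = A₁ at *
  generalize wpParam s δ y (δ / 2 - a₂) n l = A₂ at *
  generalize wpParam s δ y (δ / 2 - a₃) n l = A₃ at *
  generalize wpKernel s δ (y + l * δ + δ) x M = K' at *
  generalize wpKernel s δ (y + l * δ) x M = K at *
  -- The product of the one-step relations for the coefficient, the kernel and the four parameters.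
  have key := congrArg₂ (· * ·) (congrArg₂ (· * ·) hC hK)
    (congrArg₂ (· * ·) (congrArg₂ (· * ·) h₀ h₁) (congrArg₂ (· * ·) h₂ h₃))
  linear_combination key

omit hg in
/-- Variant of `partial_fraction_even` multiplied by the factor of the pole `±e₃`, which also
holds at `z = -e₃`. -/
theorem IsThetaBracket.partial_fraction_even_mul {z e₁ e₂ e₃ f₁ f₂ f₃ f₄ f₅ : ℂ}
    (h : e₁ + e₂ + e₃ + (f₁ + f₂ + f₃ + f₄ + f₅) = 0)
    (hD : s (f₄ + f₅) ≠ 0) (hD' : s (e₁ + e₂ + (f₂ + f₃)) ≠ 0)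
    (hz : s (2 * z) ≠ 0) (h₁ : s (z - e₁) ≠ 0) (h₂ : s (z - e₂) ≠ 0)
    (h₁' : s (z + e₁) ≠ 0) (h₂' : s (z + e₂) ≠ 0)
    (h₃ : z = -e₃ ∨ s (z - e₃) ≠ 0 ∧ s (z + e₃) ≠ 0)
    (h₁₂ : s (e₁ - e₂) ≠ 0) (h₁₃ : s (e₁ - e₃) ≠ 0) (h₂₃ : s (e₂ - e₃) ≠ 0) :
    s (z + f₁) * s (z + f₂) * s (z + f₃) * s (z + f₄) * s (z + f₅) * s (z + e₃) /
        (s (2 * z) * s (z - e₁) * s (z - e₂)) -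
      s (z - f₁) * s (z - f₂) * s (z - f₃) * s (z - f₄) * s (z - f₅) * s (z - e₃) /
        (s (2 * z) * s (z + e₁) * s (z + e₂)) =
    s (e₁ + f₁) * s (e₁ + f₂) * s (e₁ + f₃) * s (e₁ + f₄) * s (e₁ + f₅) /
        (s (e₁ - e₂) * s (e₁ - e₃)) * (s (z + e₃) * s (z - e₃) / (s (z + e₁) * s (z - e₁))) +
      s (e₂ + f₁) * s (e₂ + f₂) * s (e₂ + f₃) * s (e₂ + f₄) * s (e₂ + f₅) /
        (s (e₂ - e₁) * s (e₂ - e₃)) * (s (z + e₃) * s (z - e₃) / (s (z + e₂) * s (z - e₂))) +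
      s (e₃ + f₁) * s (e₃ + f₂) * s (e₃ + f₃) * s (e₃ + f₄) * s (e₃ + f₅) /
        (s (e₃ - e₁) * s (e₃ - e₂)) := by
  rcases h₃ with rfl | ⟨h₃, h₃'⟩
  · have hn (f : ℂ) : s (-e₃ - f) = -s (e₃ + f) := by rw [← hs.neg]; ring_nf
    have hn' (f : ℂ) : s (-e₃ + f) = -s (e₃ - f) := by rw [← hs.neg]; ring_nf
    have h0 : s (-e₃ + e₃) = 0 := by rw [neg_add_cancel, hs.zero]
    have hz' : s (2 * -e₃) = -s (e₃ + e₃) := by rw [← hs.neg]; ring_nf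
    simp only [h0, mul_zero, zero_mul, zero_div, zero_sub, zero_add]
    rw [hz'] at hz ⊢
    simp only [hn, hn', neg_ne_zero] at h₁ h₂ h₁' h₂' ⊢
    rw [neg_ne_zero] at hz
    generalize s (e₃ + e₃) = X at *
    rw [hs.sub_comm e₁ e₃] at h₁₃
    rw [hs.sub_comm e₂ e₃] at h₂₃
    field_simp
  · have := congrArg (· * (s (z + e₃) * s (z - e₃)))
      (hs.partial_fraction_even h hD hD' hz h₁ h₂ h₃ h₁' h₂' h₃' h₁₂ h₁₃ h₂₃)
    have e (A B C : ℂ) : A / (B * s (z - e₃)) * (s (z + e₃) * s (z - e₃)) =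
        A * s (z + e₃) / B := by field_simp
    have e' (A B C : ℂ) : A / (B * s (z + e₃)) * (s (z + e₃) * s (z - e₃)) =
        A * s (z - e₃) / B := by field_simp
    have e'' (A B : ℂ) : A / B / (s (z + e₃) * s (z - e₃)) * (s (z + e₃) * s (z - e₃)) =
        A / B := by field_simp
    simp only [sub_mul, add_mul] at this
    rw [e, e', e''] at this
    · rw [this]
      ring
    all_goals exact 0

omit hs in
-- Identifies a weighted sum produced by the partial fractions: the numerator of the weight shortens
-- the sum by one term and the denominator lowers b₀ by δ.
theorem sum_wpTerm_mul_div {b₀ b₁ b₂ b₃ : ℂ} (hb : GenericParam s δ x y b₀) (hs0 : s 0 = 0)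
    (hneg : ∀ u, s (-u) = -s u) (N M : ℕ) :
    s (y + b₀ - δ) * ∑ l ∈ Finset.range (N + 1 + 1),
        wpTerm s δ (N + 1) M y x (δ / 2 - b₀) (δ / 2 - b₁) (δ / 2 - b₂) (δ / 2 - b₃) l *
          (s (y + l * δ + (-y - (N + 1) * δ)) * s (y + l * δ - (-y - (N + 1) * δ)) /
            (s (y + l * δ + (b₀ - δ)) * s (y + l * δ - (b₀ - δ)))) =
      -(s ((N + 1) * δ) * (s (y + (N + 1) * δ - b₁) * s (y + (N + 1) * δ - b₂) *
        s (y + (N + 1) * δ - b₃))) *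
        wpSum s δ N M y x (δ / 2 - (b₀ - δ)) (δ / 2 - b₁) (δ / 2 - b₂) (δ / 2 - b₃) := by
  rw [Finset.sum_range_succ, show y + ((N + 1 : ℕ) : ℂ) * δ + (-y - (N + 1) * δ) = 0 by
    push_cast; ring, hs0, zero_mul, zero_div, mul_zero, add_zero, wpSum, Finset.mul_sum,
    Finset.mul_sum]
  refine Finset.sum_congr rfl fun l hl ↦ ?_
  have hl : l ≤ N := Nat.lt_succ_iff.1 (Finset.mem_range.1 hl)
  have hC := wpCoeff_succ hg hl
  have h₀ := wpParam_reflect_shift s δ y b₀ hl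
  have n₁ : s (y + l * δ + (b₀ - δ)) ≠ 0 := hb.y_add.ne (l - 1) (by push_cast; ring)
  have n₂ : s (y + l * δ - (b₀ - δ)) ≠ 0 := hb.y_sub.ne (l + 1) (by push_cast; ring)
  rw [show y + l * δ + (-y - (N + 1) * δ) = -(y + (N + 1) * δ - (y + l * δ)) by ring, hneg,
    show y + l * δ - (-y - (N + 1) * δ) = y + (N + 1) * δ + (y + l * δ) by ring]
  simp only [wpTerm, wpParam_reflect_succ s δ y b₁ hl, wpParam_reflect_succ s δ y b₂ hl,
    wpParam_reflect_succ s δ y b₃ hl]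
  rw [← eq_div_iff (mul_ne_zero n₁ n₂)] at h₀
  rw [h₀]
  linear_combination s (y + b₀ - δ) * wpParam s δ y (δ / 2 - b₀) (N + 1) l /
    (s (y + l * δ + (b₀ - δ)) * s (y + l * δ - (b₀ - δ))) *
    (wpParam s δ y (δ / 2 - b₁) N l * s (y + (N + 1) * δ - b₁)) *
    (wpParam s δ y (δ / 2 - b₂) N l * s (y + (N + 1) * δ - b₂)) *
    (wpParam s δ y (δ / 2 - b₃) N l * s (y + (N + 1) * δ - b₃)) *
    wpKernel s δ (y + l * δ) x M * hC

/-- Three-term recurrence of the dual sum in its length. -/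
theorem wpSum_succ_left {N M : ℕ} (hbal : a₀ + a₁ + a₂ + a₃ = ((N + 1 : ℂ) - M + 1) * δ) :
    s (x + y + (N + 1) * δ - δ / 2) * s (y - x - δ / 2 - M * δ + (N + 1) * δ) * s (a₀ - a₁) *
        wpSum s δ (N + 1) M y x (δ / 2 - a₀) (δ / 2 - a₁) (δ / 2 - a₂) (δ / 2 - a₃) =
      s (x + δ / 2 - a₀) * s (x + M * δ - δ / 2 + a₀) *
          (s (a₀ + a₂ - δ) * s (a₀ + a₃ - δ)) *
          (s (y + (N + 1) * δ - a₁) * s (y + (N + 1) * δ + a₁ - δ)) *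
          wpSum s δ N M y x (δ / 2 - (a₀ - δ)) (δ / 2 - a₁) (δ / 2 - a₂) (δ / 2 - a₃) -
        s (x + δ / 2 - a₁) * s (x + M * δ - δ / 2 + a₁) *
          (s (a₁ + a₂ - δ) * s (a₁ + a₃ - δ)) *
          (s (y + (N + 1) * δ - a₀) * s (y + (N + 1) * δ + a₀ - δ)) *
          wpSum s δ N M y x (δ / 2 - a₀) (δ / 2 - (a₁ - δ)) (δ / 2 - a₂) (δ / 2 - a₃) := by
  set T : ℕ → ℂ := fun l ↦
    wpTerm s δ (N + 1) M y x (δ / 2 - a₀) (δ / 2 - a₁) (δ / 2 - a₂) (δ / 2 - a₃) l with hT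
  -- P and Q are the two sides of the consecutive-term relation, T(l+1)Q(z+δ) = T(l)P(z), and P - Q
  -- is the even function to be expanded.
  set P : ℂ → ℂ := fun z ↦ s (z + y) * s (z + (x + δ / 2 + M * δ)) * s (z + (δ / 2 - x)) *
    s (z + a₂) * s (z + a₃) * s (z + (-y - (N + 1) * δ)) /
    (s (2 * z) * s (z - (a₀ - δ)) * s (z - (a₁ - δ))) with hP
  set Q : ℂ → ℂ := fun z ↦ s (z - y) * s (z - (x + δ / 2 + M * δ)) * s (z - (δ / 2 - x)) *
    s (z - a₂) * s (z - a₃) * s (z - (-y - (N + 1) * δ)) /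
    (s (2 * z) * s (z + (a₀ - δ)) * s (z + (a₁ - δ))) with hQ
  -- The sum telescopes; the boundary terms vanish through s(z - y) in Q at l = 0 and s(z - y -
  -- (N+1)δ) in P at l = N + 1.
  have hsum : ∑ l ∈ Finset.range (N + 1 + 1), T l * (P (y + l * δ) - Q (y + l * δ)) = 0 := by
    simp only [mul_sub]
    rw [Finset.sum_sub_distrib, Finset.sum_range_succ,
      Finset.sum_range_succ' fun l ↦ T l * Q (y + l * δ)]
    have hlast : P (y + ((N + 1 : ℕ) : ℂ) * δ) = 0 := by
      have : s (y + ((N + 1 : ℕ) : ℂ) * δ + (-y - (N + 1) * δ)) = 0 := by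
        rw [← hs.zero]; push_cast; ring_nf
      simp only [hP, this, mul_zero, zero_div]
    have hfirst : Q (y + ((0 : ℕ) : ℂ) * δ) = 0 := by
      have : s (y + ((0 : ℕ) : ℂ) * δ - y) = 0 := by
        rw [← hs.zero]; push_cast; ring_nf
      simp only [hQ, this, zero_mul, zero_div]
    rw [hlast, hfirst, mul_zero, mul_zero, add_zero, add_zero, sub_eq_zero]
    refine Finset.sum_congr rfl fun l hl ↦ ?_
    have := wpTerm_telescope hs hg (M := M) (Finset.mem_range.1 hl)
    push_cast at this
    simp only [hP, hQ]
    rw [show y + ((l + 1 : ℕ) : ℂ) * δ = y + l * δ + δ by push_cast; ring, ← mul_div_assoc,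
      ← mul_div_assoc]
    exact this.symm
  have key (l : ℕ) (hl : l ≤ N + 1) := congrArg (T l * ·) <| hs.partial_fraction_even_mul
    (z := y + l * δ) (e₁ := a₀ - δ)
    (e₂ := a₁ - δ) (e₃ := -y - (N + 1) * δ) (f₁ := y) (f₂ := x + δ / 2 + M * δ)
    (f₃ := δ / 2 - x) (f₄ := a₂) (f₅ := a₃) (by linear_combination hbal)
    (hg.add₂₃.ne 0 (by push_cast; ring)) (hg.add₀₁.ne (M - 1) (by push_cast; ring))
    (hg.two_y.ne (2 * l) (by push_cast; ring))
    (hg.param₀.y_sub.ne (l + 1) (by push_cast; ring))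
    (hg.param₁.y_sub.ne (l + 1) (by push_cast; ring))
    (hg.param₀.y_add.ne (l - 1) (by push_cast; ring))
    (hg.param₁.y_add.ne (l - 1) (by push_cast; ring))
    (by
      -- The last term sits on the pole z = -e₃, hence the version multiplied by the factor of that
      -- pole.
      rcases hl.eq_or_lt with rfl | hl
      · left; push_cast; ring
      · right
        obtain ⟨m, hm⟩ := Nat.exists_eq_add_of_lt hl
        have hm : (N : ℂ) + 1 = l + m + 1 := by exact_mod_cast hm
        refine ⟨hg.two_y.ne (l + N + 1) (by push_cast; ring), ?_⟩
        rw [show y + l * δ + (-y - (N + 1) * δ) = -(δ + m * δ) by rw [hm]; ring, hs.neg,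
          neg_ne_zero]
        exact hg.base m)
    (hg.sub₀₁.ne 0 (by push_cast; ring)) (hg.param₀.y_add.ne N (by push_cast; ring))
    (hg.param₁.y_add.ne N (by push_cast; ring))
  replace hsum := (Finset.sum_congr rfl fun l hl ↦ key l
    (Nat.lt_succ_iff.1 (Finset.mem_range (n := N + 1 + 1).1 hl))).symm.trans hsum
  -- The e₃ part has constant weight and gives the sum of length N + 1; the e₁ and e₂ parts give
  -- sums of length N with a₀ or a₁ lowered.
  beta_reduce at hsum
  simp only [mul_add, mul_left_comm (T _)] at hsum
  rw [Finset.sum_add_distrib, Finset.sum_add_distrib, ← Finset.mul_sum, ← Finset.mul_sum,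
    ← Finset.sum_mul] at hsum
  have h0 := sum_wpTerm_mul_div hg (b₀ := a₀) (b₁ := a₁) (b₂ := a₂) (b₃ := a₃) hg.param₀
    hs.zero hs.neg N M
  have h1 := sum_wpTerm_mul_div hg (b₀ := a₁) (b₁ := a₀) (b₂ := a₂) (b₃ := a₃) hg.param₁
    hs.zero hs.neg N M
  rw [wpSum_swap₀₁] at h1
  have hswap (l : ℕ) :
      wpTerm s δ (N + 1) M y x (δ / 2 - a₁) (δ / 2 - a₀) (δ / 2 - a₂) (δ / 2 - a₃) l = T l := by
    simp only [hT, wpTerm]; ring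
  simp only [hswap] at h1
  change s (y + a₀ - δ) * ∑ l ∈ Finset.range (N + 1 + 1), T l * _ = _ at h0
  have hn : s ((N + 1) * δ) ≠ 0 := by
    rw [show ((N : ℂ) + 1) * δ = δ + N * δ by ring]; exact hg.base N
  have n₀ : s (y + a₀ - δ) ≠ 0 := hg.param₀.y_add.ne (-1) (by push_cast; ring)
  have n₁ : s (y + a₁ - δ) ≠ 0 := hg.param₁.y_add.ne (-1) (by push_cast; ring)
  have m₀ : s (y + (N + 1) * δ + a₀ - δ) ≠ 0 := hg.param₀.y_add.ne N (by push_cast; ring)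
  have m₁ : s (y + (N + 1) * δ + a₁ - δ) ≠ 0 := hg.param₁.y_add.ne N (by push_cast; ring)
  have r₂ : s (y + (N + 1) * δ - a₂) ≠ 0 := hg.param₂.y_sub.ne (N + 1) (by push_cast; ring)
  have r₃ : s (y + (N + 1) * δ - a₃) ≠ 0 := hg.param₃.y_sub.ne (N + 1) (by push_cast; ring)
  have d₀₁ : s (a₀ - a₁) ≠ 0 := hg.sub₀₁.ne 0 (by push_cast; ring)
  rw [mul_comm, ← eq_div_iff n₀] at h0
  rw [mul_comm, ← eq_div_iff n₁] at h1
  rw [h0, h1] at hsum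
  rw [show wpSum s δ (N + 1) M y x (δ / 2 - a₀) (δ / 2 - a₁) (δ / 2 - a₂) (δ / 2 - a₃) =
    ∑ l ∈ Finset.range (N + 1 + 1), T l from rfl]
  generalize wpSum s δ N M y x (δ / 2 - (a₀ - δ)) (δ / 2 - a₁) (δ / 2 - a₂) (δ / 2 - a₃) = S₀ at *
  generalize wpSum s δ N M y x (δ / 2 - a₀) (δ / 2 - (a₁ - δ)) (δ / 2 - a₂) (δ / 2 - a₃) = S₁ at *
  generalize ∑ l ∈ Finset.range (N + 1 + 1), T l = S at *
  clear h0 h1 key hswap hP hQ hT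
  have ng (u v : ℂ) (h : u = -v) : s u = -s v := by rw [h, hs.neg]
  rw [show a₀ - δ + y = y + a₀ - δ by ring, show a₁ - δ + y = y + a₁ - δ by ring,
    show a₀ - δ + (x + δ / 2 + M * δ) = x + M * δ - δ / 2 + a₀ by ring,
    show a₁ - δ + (x + δ / 2 + M * δ) = x + M * δ - δ / 2 + a₁ by ring,
    ng (a₀ - δ + (δ / 2 - x)) (x + δ / 2 - a₀) (by ring),
    ng (a₁ - δ + (δ / 2 - x)) (x + δ / 2 - a₁) (by ring),
    show a₀ - δ + a₂ = a₀ + a₂ - δ by ring, show a₀ - δ + a₃ = a₀ + a₃ - δ by ring,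
    show a₁ - δ + a₂ = a₁ + a₂ - δ by ring, show a₁ - δ + a₃ = a₁ + a₃ - δ by ring,
    show a₀ - δ - (a₁ - δ) = a₀ - a₁ by ring, ng (a₁ - δ - (a₀ - δ)) (a₀ - a₁) (by ring),
    show a₀ - δ - (-y - (N + 1) * δ) = y + (N + 1) * δ + a₀ - δ by ring,
    show a₁ - δ - (-y - (N + 1) * δ) = y + (N + 1) * δ + a₁ - δ by ring,
    ng (-y - (N + 1) * δ - (a₀ - δ)) (y + (N + 1) * δ + a₀ - δ) (by ring),
    ng (-y - (N + 1) * δ - (a₁ - δ)) (y + (N + 1) * δ + a₁ - δ) (by ring),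
    ng (-y - (N + 1) * δ + y) ((N + 1) * δ) (by ring),
    ng (-y - (N + 1) * δ + (x + δ / 2 + M * δ)) (y - x - δ / 2 - M * δ + (N + 1) * δ) (by ring),
    ng (-y - (N + 1) * δ + (δ / 2 - x)) (x + y + (N + 1) * δ - δ / 2) (by ring),
    ng (-y - (N + 1) * δ + a₂) (y + (N + 1) * δ - a₂) (by ring),
    ng (-y - (N + 1) * δ + a₃) (y + (N + 1) * δ - a₃) (by ring)] at hsum
  generalize s ((N + 1) * δ) = c₀ at *
  generalize s (y + a₀ - δ) = c₁ at *
  generalize s (y + a₁ - δ) = c₂ at *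
  generalize s (y + (N + 1) * δ + a₀ - δ) = c₃ at *
  generalize s (y + (N + 1) * δ + a₁ - δ) = c₄ at *
  generalize s (y + (N + 1) * δ - a₀) = c₅ at *
  generalize s (y + (N + 1) * δ - a₁) = c₆ at *
  generalize s (y + (N + 1) * δ - a₂) = c₇ at *
  generalize s (y + (N + 1) * δ - a₃) = c₈ at *
  generalize s (a₀ - a₁) = c₉ at *
  generalize s (x + M * δ - δ / 2 + a₀) = d₀ at *
  generalize s (x + M * δ - δ / 2 + a₁) = d₁ at *
  generalize s (x + δ / 2 - a₀) = d₂ at *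
  generalize s (x + δ / 2 - a₁) = d₃ at *
  generalize s (y - x - δ / 2 - M * δ + (N + 1) * δ) = d₄ at *
  generalize s (x + y + (N + 1) * δ - δ / 2) = d₅ at *
  field_simp at hsum
  refine mul_left_cancel₀ (mul_ne_zero (mul_ne_zero hn r₂) r₃) ?_
  linear_combination -hsum

end

/-! ### The duality by induction on the kernel degree. -/

/-- The quotient of shifted factorials attached to a sum `u` of two parameters. -/
noncomputable def dualRatio (s : ℂ → ℂ) (δ u : ℂ) (M N : ℕ) : ℂ :=
  shiftedProd s δ u M / shiftedProd s δ ((1 - M) * δ - u) N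

/-- The duality between the sums of lengths `M` and `N`. -/
def Duality (s : ℂ → ℂ) (δ : ℂ) (M N : ℕ) (x y a₀ a₁ a₂ a₃ : ℂ) : Prop :=
  wpSum s δ M N x y a₀ a₁ a₂ a₃ =
    (-1) ^ N * (shiftedProd s δ (x + y + δ / 2) N * shiftedProd s δ (y - x + δ / 2 - M * δ) N) /
        (shiftedProd s δ (x + y + δ / 2) M * shiftedProd s δ (y - x + δ / 2 - M * δ) M) *
      (dualRatio s δ (a₀ + a₁) M N * dualRatio s δ (a₀ + a₂) M N * dualRatio s δ (a₀ + a₃) M N) *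
      wpSum s δ N M y x (δ / 2 - a₀) (δ / 2 - a₁) (δ / 2 - a₂) (δ / 2 - a₃)

section

variable {s : ℂ → ℂ} {δ : ℂ}

theorem dualRatio_sub (hs : ∀ u, s (-u) = -s u) {u : ℂ} (hu : NonvanishingOn s δ u) (M N : ℕ) :
    dualRatio s δ (u - δ) M N = -s (u - δ) * dualRatio s δ u M (N + 1) := by
  have h := mul_shiftedProd_add s δ (u - δ) M
  rw [sub_add_cancel] at h
  have e : s ((1 - M) * δ - u) = -s (u - δ + M * δ) := by rw [← hs]; ring_nf
  have n₁ : s (u - δ + M * δ) ≠ 0 := hu.ne (M - 1) (by push_cast; ring)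
  have n₂ : shiftedProd s δ ((1 - M) * δ - (u - δ)) N ≠ 0 :=
    (hu.reflect hs 0 (by push_cast; ring) : NonvanishingOn s δ (-u)).shiftedProd_ne_zero
      (2 - M) (by push_cast; ring) N
  simp only [dualRatio]
  rw [shiftedProd_succ', e, show (1 - M) * δ - u + δ = (1 - M) * δ - (u - δ) by ring]
  generalize s (u - δ + M * δ) = X at *
  generalize shiftedProd s δ ((1 - M) * δ - (u - δ)) N = Y at *
  field_simp
  linear_combination -h

theorem dualRatio_succ (hs : ∀ u, s (-u) = -s u) {u : ℂ} (hu : NonvanishingOn s δ u) (M N : ℕ) :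
    dualRatio s δ u M N = s ((1 - M + N) * δ - u) * dualRatio s δ u M (N + 1) := by
  have n₁ : s ((1 - M) * δ - u + N * δ) ≠ 0 :=
    (hu.reflect hs 0 (by push_cast; ring) : NonvanishingOn s δ (-u)).ne (1 - M + N)
      (by push_cast; ring)
  have n₂ : shiftedProd s δ ((1 - M) * δ - u) N ≠ 0 :=
    (hu.reflect hs 0 (by push_cast; ring) : NonvanishingOn s δ (-u)).shiftedProd_ne_zero
      (1 - M) (by push_cast; ring) N
  simp only [dualRatio]
  rw [shiftedProd_succ, show (1 - M + N) * δ - u = (1 - M) * δ - u + N * δ by ring]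
  generalize s ((1 - M) * δ - u + N * δ) = X at *
  field_simp

/-- Both sides obey the same three-term recurrence once the prefactors are transported;
s(a₀+a₁-δ)s(a₀-a₁) is then cancelled by genericity. -/
theorem duality_succ (hs : IsThetaBracket s) {M N : ℕ} {x y : ℂ}
    (ih : ∀ a₀ a₁ a₂ a₃, Generic s δ x y a₀ a₁ a₂ a₃ →
      a₀ + a₁ + a₂ + a₃ = ((N : ℂ) - M + 1) * δ → Duality s δ M N x y a₀ a₁ a₂ a₃)
    {a₀ a₁ a₂ a₃ : ℂ} (hg : Generic s δ x y a₀ a₁ a₂ a₃)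
    (hbal : a₀ + a₁ + a₂ + a₃ = ((N + 1 : ℂ) - M + 1) * δ) :
    Duality s δ M (N + 1) x y a₀ a₁ a₂ a₃ := by
  have hL := wpSum_succ_right (δ := δ) hs M N x y a₀ a₁ a₂ a₃
  have hR := wpSum_succ_left hs hg hbal
  have h₀ := ih _ _ _ _ hg.shift₀ (by linear_combination hbal)
  have h₁ := ih _ _ _ _ hg.shift₁ (by linear_combination hbal)
  unfold Duality at h₀ h₁ ⊢
  rw [show a₀ - δ + a₁ = a₀ + a₁ - δ by ring, show a₀ - δ + a₂ = a₀ + a₂ - δ by ring,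
    show a₀ - δ + a₃ = a₀ + a₃ - δ by ring, dualRatio_sub hs.neg hg.add₀₁,
    dualRatio_sub hs.neg hg.add₀₂, dualRatio_sub hs.neg hg.add₀₃] at h₀
  rw [show a₀ + (a₁ - δ) = a₀ + a₁ - δ by ring, dualRatio_sub hs.neg hg.add₀₁,
    dualRatio_succ hs.neg hg.add₀₂, dualRatio_succ hs.neg hg.add₀₃,
    -- Balancing converts complementary pairs of parameters, so the a₁-shifted term acquires the
    -- coefficients of the dual recurrence.
    show (1 - M + N) * δ - (a₀ + a₂) = a₁ + a₃ - δ by linear_combination -hbal,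
    show (1 - M + N) * δ - (a₀ + a₃) = a₁ + a₂ - δ by linear_combination -hbal] at h₁
  rw [h₀, h₁, show s (δ - a₀ - a₁) = -s (a₀ + a₁ - δ) by rw [← hs.neg]; ring_nf,
    hs.sub_comm a₁ a₀] at hL
  have n₁ : s (a₀ + a₁ - δ) ≠ 0 := hg.add₀₁.ne (-1) (by push_cast; ring)
  have n₂ : s (a₀ - a₁) ≠ 0 := hg.sub₀₁.ne 0 (by push_cast; ring)
  rw [shiftedProd_succ, shiftedProd_succ, show x + y + δ / 2 + N * δ =
    x + y + (N + 1) * δ - δ / 2 by ring, show y - x + δ / 2 - M * δ + N * δ =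
    y - x - δ / 2 - M * δ + (N + 1) * δ by ring]
  refine mul_left_cancel₀ (mul_ne_zero n₁ n₂) ?_
  rw [pow_succ]
  linear_combination hL + s (a₀ + a₁ - δ) * ((-1) ^ N *
    (shiftedProd s δ (x + y + δ / 2) N * shiftedProd s δ (y - x + δ / 2 - M * δ) N) /
    (shiftedProd s δ (x + y + δ / 2) M * shiftedProd s δ (y - x + δ / 2 - M * δ) M)) *
    (dualRatio s δ (a₀ + a₁) M (N + 1) * dualRatio s δ (a₀ + a₂) M (N + 1) *
      dualRatio s δ (a₀ + a₃) M (N + 1)) * hR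

theorem wpSum_zero_left {x : ℂ} (hx : s (2 * x) ≠ 0) (N : ℕ) (y a₀ a₁ a₂ a₃ : ℂ) :
    wpSum s δ 0 N x y a₀ a₁ a₂ a₃ = wpKernel s δ x y N := by
  simp [wpSum, wpTerm, wpCoeff, wpParam, shiftedProd_succ, hx]

theorem duality_zero_left (hs : IsThetaBracket s) {N : ℕ} {x y a₀ a₁ a₂ a₃ : ℂ}
    (hg : Generic s δ x y a₀ a₁ a₂ a₃)
    (hbal : a₀ + a₁ + a₂ + a₃ = ((N : ℂ) - (0 : ℕ) + 1) * δ) :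
    Duality s δ 0 N x y a₀ a₁ a₂ a₃ := by
  induction N generalizing a₀ a₁ a₂ a₃ with
  | zero =>
    rw [Duality, wpSum_zero_left (hg.two_x.ne 0 (by simp)),
      wpSum_zero_left (hg.two_y.ne 0 (by simp))]
    simp [dualRatio, wpKernel]
  | succ N ih =>
    exact duality_succ hs (fun _ _ _ _ ↦ ih) hg (by rw [hbal]; push_cast; ring)

/-- The case of length zero, applied after exchanging x with y and a_p with δ/2 - a_p, then solved
for the other sum. -/
theorem duality_zero_right (hs : IsThetaBracket s) {M : ℕ} {x y a₀ a₁ a₂ a₃ : ℂ}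
    (hg : Generic s δ x y a₀ a₁ a₂ a₃)
    (hbal : a₀ + a₁ + a₂ + a₃ = (((0 : ℕ) : ℂ) - M + 1) * δ) :
    Duality s δ M 0 x y a₀ a₁ a₂ a₃ := by
  have h := duality_zero_left hs (N := M) (hg.symm hs.neg)
    (by push_cast at *; linear_combination -hbal)
  have hrev := shiftedProd_neg δ (y - x - δ / 2) M hs.neg
  rw [show -(y - x - δ / 2) = x - y + δ / 2 by ring,
    show y - x - δ / 2 + δ - M * δ = y - x + δ / 2 - M * δ by ring] at hrev
  have n₁ : shiftedProd s δ (x + y + δ / 2) M ≠ 0 :=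
    hg.add_xy.shiftedProd_ne_zero 0 (by push_cast; ring) M
  have n₂ : shiftedProd s δ (y - x + δ / 2 - M * δ) M ≠ 0 :=
    hg.sub_xy.shiftedProd_ne_zero (-M) (by push_cast; ring) M
  have m₁ := hg.add₀₁.shiftedProd_ne_zero 0 (v := a₀ + a₁) (by push_cast; ring) M
  have m₂ := hg.add₀₂.shiftedProd_ne_zero 0 (v := a₀ + a₂) (by push_cast; ring) M
  have m₃ := hg.add₀₃.shiftedProd_ne_zero 0 (v := a₀ + a₃) (by push_cast; ring) M
  have e (b c : ℂ) : (1 - ((0 : ℕ) : ℂ)) * δ - (δ / 2 - b + (δ / 2 - c)) = b + c := by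
    push_cast; ring
  rw [Duality, wpSum_zero_left (hg.two_y.ne 0 (by simp))] at h ⊢
  simp only [sub_sub_cancel, dualRatio, e, shiftedProd_zero] at h ⊢
  rw [show y + x + δ / 2 = x + y + δ / 2 by ring,
    show x - y + δ / 2 - ((0 : ℕ) : ℂ) * δ = x - y + δ / 2 by push_cast; ring, hrev] at h
  rw [h]
  have hsq : ((-1 : ℂ) ^ M) * (-1) ^ M = 1 := by rw [← mul_pow]; simp
  generalize shiftedProd s δ (x + y + δ / 2) M = X at *
  generalize shiftedProd s δ (y - x + δ / 2 - M * δ) M = Y at *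
  field_simp
  linear_combination -(wpSum s δ M 0 x y a₀ a₁ a₂ a₃) * hsq

theorem duality (hs : IsThetaBracket s) {M N : ℕ} {x y a₀ a₁ a₂ a₃ : ℂ}
    (hg : Generic s δ x y a₀ a₁ a₂ a₃)
    (hbal : a₀ + a₁ + a₂ + a₃ = ((N : ℂ) - M + 1) * δ) :
    Duality s δ M N x y a₀ a₁ a₂ a₃ := by
  induction N generalizing a₀ a₁ a₂ a₃ with
  | zero => exact duality_zero_right hs hg hbal
  | succ N ih =>
    exact duality_succ hs (fun _ _ _ _ ↦ ih) hg (by rw [hbal]; push_cast; ring)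

end

/-! ### From the cleared sums back to the series. -/

/-- The general term of the terminating very well-poised series `₁₂V₁₁`. -/
noncomputable def seriesTerm (s : ℂ → ℂ) (δ : ℂ) (M N : ℕ) (x y a₀ a₁ a₂ a₃ : ℂ) (k : ℕ) : ℂ :=
  s (2 * x + 2 * k * δ) / s (2 * x) * (shiftedProd s δ (2 * x) k / shiftedProd s δ δ k) *
    ((shiftedProd s δ (x + δ / 2 - a₀) k / shiftedProd s δ (x + δ / 2 + a₀) k) *
      ((shiftedProd s δ (x + δ / 2 - a₁) k / shiftedProd s δ (x + δ / 2 + a₁) k) *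
      ((shiftedProd s δ (x + δ / 2 - a₂) k / shiftedProd s δ (x + δ / 2 + a₂) k) *
      ((shiftedProd s δ (x + δ / 2 - a₃) k / shiftedProd s δ (x + δ / 2 + a₃) k) *
      ((shiftedProd s δ (x + y + δ / 2 + N * δ) k / shiftedProd s δ (x - y + δ / 2 - N * δ) k) *
      ((shiftedProd s δ (x - y + δ / 2) k / shiftedProd s δ (x + y + δ / 2) k) *
      (shiftedProd s δ (-(M * δ)) k / shiftedProd s δ (2 * x + δ + M * δ) k)))))))

/-- The terminating very well-poised series `₁₂V₁₁` as a finite sum. -/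
noncomputable def seriesSum (s : ℂ → ℂ) (δ : ℂ) (M N : ℕ) (x y a₀ a₁ a₂ a₃ : ℂ) : ℂ :=
  ∑ k ∈ Finset.range (M + 1), seriesTerm s δ M N x y a₀ a₁ a₂ a₃ k

section

variable {s : ℂ → ℂ} {δ : ℂ}

theorem shiftedProd_comm (s : ℂ → ℂ) (δ u : ℂ) (k m : ℕ) :
    shiftedProd s δ u k * shiftedProd s δ (u + k * δ) m =
      shiftedProd s δ u m * shiftedProd s δ (u + m * δ) k := by
  rw [← shiftedProd_add, add_comm, shiftedProd_add]

theorem wpParam_eq_div_mul {x a : ℂ} {M k : ℕ} (hk : k ≤ M)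
    (h : shiftedProd s δ (x + δ / 2 + a) M ≠ 0) :
    wpParam s δ x a M k = shiftedProd s δ (x + δ / 2 - a) k / shiftedProd s δ (x + δ / 2 + a) k *
      shiftedProd s δ (x + δ / 2 + a) M := by
  have h' := shiftedProd_ne_zero_of_le k h hk
  obtain ⟨m, rfl⟩ := Nat.exists_eq_add_of_le hk
  simp only [wpParam, Nat.add_sub_cancel_left]
  rw [shiftedProd_add s δ (x + δ / 2 + a)]
  generalize shiftedProd s δ (x + δ / 2 + a) k = X at *
  field_simp

theorem wpKernel_eq_div_mul {x y : ℂ} {N k : ℕ}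
    (h₁ : shiftedProd s δ (x + y + δ / 2) k ≠ 0)
    (h₂ : shiftedProd s δ (x - y + δ / 2 - N * δ) k ≠ 0) :
    wpKernel s δ (x + k * δ) y N =
      shiftedProd s δ (x + y + δ / 2 + N * δ) k / shiftedProd s δ (x - y + δ / 2 - N * δ) k *
      (shiftedProd s δ (x - y + δ / 2) k / shiftedProd s δ (x + y + δ / 2) k) *
      wpKernel s δ x y N := by
  have e₁ := shiftedProd_comm s δ (x + y + δ / 2) k N
  have e₂ := shiftedProd_comm s δ (x - y + δ / 2 - N * δ) k N
  rw [sub_add_cancel] at e₂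
  simp only [wpKernel]
  rw [show x + k * δ + y + δ / 2 = x + y + δ / 2 + k * δ by ring,
    show x + k * δ - y + δ / 2 - N * δ = x - y + δ / 2 - N * δ + k * δ by ring]
  generalize shiftedProd s δ (x + y + δ / 2) k = X₁ at *
  generalize shiftedProd s δ (x - y + δ / 2 - N * δ) k = X₂ at *
  generalize shiftedProd s δ (x + y + δ / 2 + k * δ) N = X₃ at *
  generalize shiftedProd s δ (x - y + δ / 2 - N * δ + k * δ) N = X₄ at *
  generalize shiftedProd s δ (x - y + δ / 2 - N * δ) N = X₅ at *
  generalize shiftedProd s δ (x + y + δ / 2 + N * δ) k = X₆ at *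
  generalize shiftedProd s δ (x + y + δ / 2) N = X₇ at *
  generalize shiftedProd s δ (x - y + δ / 2) k = X₈ at *
  field_simp
  linear_combination X₂ * X₄ * e₁ + X₆ * X₇ * e₂

/-- Rests on [-Mδ]_k [δ]_{M-k} = (-1)^k [δ]_M and on two factorizations of [2x]_{M+1+k}. -/
theorem wpCoeff_mul {x y a₀ a₁ a₂ a₃ : ℂ} (hs : IsThetaBracket s)
    (hg : Generic s δ x y a₀ a₁ a₂ a₃) {M k : ℕ} (hk : k ≤ M) :
    wpCoeff s δ x M k * shiftedProd s δ (2 * x + δ) M =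
      s (2 * x + 2 * k * δ) / s (2 * x) * (shiftedProd s δ (2 * x) k / shiftedProd s δ δ k) *
        (shiftedProd s δ (-(M * δ)) k / shiftedProd s δ (2 * x + δ + M * δ) k) := by
  have n₁ : s (2 * x) ≠ 0 := hg.two_x.ne 0 (by simp)
  have n₂ := hg.shiftedProd_base_ne_zero k
  have n₃ := hg.shiftedProd_base_ne_zero (M - k)
  have n₄ := hg.two_x.shiftedProd_ne_zero (M + 1) (v := 2 * x + δ + M * δ) (by push_cast; ring) k
  have n₅ := hg.two_x.shiftedProd_ne_zero k (v := 2 * x + k * δ) (by push_cast; ring) (M + 1)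
  have e₁ : shiftedProd s δ (2 * x) k * shiftedProd s δ (2 * x + k * δ) (M + 1) =
      s (2 * x) * shiftedProd s δ (2 * x + δ) M * shiftedProd s δ (2 * x + δ + M * δ) k := by
    rw [shiftedProd_comm, shiftedProd_succ',
      show 2 * x + δ + M * δ = 2 * x + ((M + 1 : ℕ) : ℂ) * δ by push_cast; ring]
  have e₂ : shiftedProd s δ (-(M * δ)) k * shiftedProd s δ δ (M - k) =
      (-1) ^ k * shiftedProd s δ δ M := by
    obtain ⟨m, rfl⟩ := Nat.exists_eq_add_of_le hk
    rw [shiftedProd_neg _ _ _ hs.neg, Nat.add_sub_cancel_left, add_comm k m, shiftedProd_add,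
      show ((m + k : ℕ) : ℂ) * δ + δ - k * δ = δ + m * δ by push_cast; ring]
    ring
  rw [wpCoeff, show 2 * (x + k * δ) = 2 * x + 2 * k * δ by ring]
  generalize shiftedProd s δ (2 * x + δ + M * δ) k = X₁ at *
  generalize shiftedProd s δ (2 * x + k * δ) (M + 1) = X₂ at *
  generalize shiftedProd s δ (-(M * δ)) k = X₃ at *
  generalize shiftedProd s δ (2 * x) k = X₄ at *
  generalize shiftedProd s δ (2 * x + δ) M = X₅ at *
  generalize s (2 * x + 2 * k * δ) = X₆ at *
  generalize s (2 * x) = X₇ at *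
  field_simp
  linear_combination -X₆ * X₃ * shiftedProd s δ δ (M - k) * e₁ - X₆ * X₇ * X₅ * X₁ * e₂

theorem seriesSum_mul {x y a₀ a₁ a₂ a₃ : ℂ} (hs : IsThetaBracket s)
    (hg : Generic s δ x y a₀ a₁ a₂ a₃) (M N : ℕ) :
    wpSum s δ M N x y a₀ a₁ a₂ a₃ * shiftedProd s δ (2 * x + δ) M =
      seriesSum s δ M N x y a₀ a₁ a₂ a₃ *
        (shiftedProd s δ (x + δ / 2 + a₀) M * shiftedProd s δ (x + δ / 2 + a₁) M *
          shiftedProd s δ (x + δ / 2 + a₂) M * shiftedProd s δ (x + δ / 2 + a₃) M *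
          wpKernel s δ x y N) := by
  rw [wpSum, seriesSum, Finset.sum_mul, Finset.sum_mul]
  refine Finset.sum_congr rfl fun k hk ↦ ?_
  have hk : k ≤ M := Nat.lt_succ_iff.1 (Finset.mem_range.1 hk)
  have h₁ := hg.add_xy.shiftedProd_ne_zero 0 (v := x + y + δ / 2) (by push_cast; ring) k
  have h₂ : shiftedProd s δ (x - y + δ / 2 - N * δ) k ≠ 0 :=
    (hg.sub_xy.reflect hs.neg 0 rfl).shiftedProd_ne_zero (1 - N) (by push_cast; ring) k
  have hc := wpCoeff_mul hs hg hk
  rw [wpTerm, wpKernel_eq_div_mul h₁ h₂,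
    wpParam_eq_div_mul hk (hg.param₀.x_add.shiftedProd_ne_zero 0 (by push_cast; ring) M),
    wpParam_eq_div_mul hk (hg.param₁.x_add.shiftedProd_ne_zero 0 (by push_cast; ring) M),
    wpParam_eq_div_mul hk (hg.param₂.x_add.shiftedProd_ne_zero 0 (by push_cast; ring) M),
    wpParam_eq_div_mul hk (hg.param₃.x_add.shiftedProd_ne_zero 0 (by push_cast; ring) M),
    mul_right_comm, mul_right_comm (wpCoeff s δ x M k), hc, seriesTerm]
  ring

/-- The duality transformation for generic parameters. -/
theorem seriesSum_duality {x y a₀ a₁ a₂ a₃ : ℂ} (hs : IsThetaBracket s)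
    (hg : Generic s δ x y a₀ a₁ a₂ a₃) {M N : ℕ}
    (hbal : a₀ + a₁ + a₂ + a₃ = ((N : ℂ) - M + 1) * δ) :
    seriesSum s δ M N x y a₀ a₁ a₂ a₃ =
      (dualRatio s δ (a₀ + a₁) M N * dualRatio s δ (a₀ + a₂) M N * dualRatio s δ (a₀ + a₃) M N) *
      (shiftedProd s δ (y + δ / 2 + (δ / 2 - a₀)) N / shiftedProd s δ (x + δ / 2 + a₀) M *
        (shiftedProd s δ (y + δ / 2 + (δ / 2 - a₁)) N / shiftedProd s δ (x + δ / 2 + a₁) M) *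
        (shiftedProd s δ (y + δ / 2 + (δ / 2 - a₂)) N / shiftedProd s δ (x + δ / 2 + a₂) M) *
        (shiftedProd s δ (y + δ / 2 + (δ / 2 - a₃)) N / shiftedProd s δ (x + δ / 2 + a₃) M)) *
      (shiftedProd s δ (2 * x + δ) M / shiftedProd s δ (2 * y + δ) N) *
      (shiftedProd s δ (y - x + δ / 2 - M * δ) N / shiftedProd s δ (y - x + δ / 2) N) *
      seriesSum s δ N M y x (δ / 2 - a₀) (δ / 2 - a₁) (δ / 2 - a₂) (δ / 2 - a₃) := by
  have hg' := hg.symm hs.neg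
  have hL := seriesSum_mul hs hg M N
  have hR := seriesSum_mul hs hg' N M
  have hD := duality hs hg hbal
  -- Reversing this product gives a sign (-1)^N that cancels the one in `Duality`.
  have hrev := shiftedProd_neg δ (y - x - δ / 2 + N * δ) N hs.neg
  rw [show -(y - x - δ / 2 + N * δ) = x - y + δ / 2 - N * δ by ring,
    show y - x - δ / 2 + N * δ + δ - N * δ = y - x + δ / 2 by ring] at hrev
  rw [Duality] at hD
  simp only [wpKernel] at hL hR
  rw [hrev] at hL
  rw [add_comm y x] at hR
  have n₁ : shiftedProd s δ (x + y + δ / 2) M ≠ 0 :=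
    hg.add_xy.shiftedProd_ne_zero 0 (by push_cast; ring) M
  have n₂ : shiftedProd s δ (x + y + δ / 2) N ≠ 0 :=
    hg.add_xy.shiftedProd_ne_zero 0 (by push_cast; ring) N
  have n₃ : shiftedProd s δ (y - x + δ / 2 - M * δ) M ≠ 0 :=
    hg.sub_xy.shiftedProd_ne_zero (-M) (by push_cast; ring) M
  have n₄ : shiftedProd s δ (y - x + δ / 2) N ≠ 0 :=
    hg.sub_xy.shiftedProd_ne_zero 0 (by push_cast; ring) N
  have n₅ : shiftedProd s δ (2 * y + δ) N ≠ 0 :=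
    hg.two_y.shiftedProd_ne_zero 1 (by push_cast; ring) N
  have p₀ := hg.param₀.x_add.shiftedProd_ne_zero 0 (v := x + δ / 2 + a₀) (by push_cast; ring) M
  have p₁ := hg.param₁.x_add.shiftedProd_ne_zero 0 (v := x + δ / 2 + a₁) (by push_cast; ring) M
  have p₂ := hg.param₂.x_add.shiftedProd_ne_zero 0 (v := x + δ / 2 + a₂) (by push_cast; ring) M
  have p₃ := hg.param₃.x_add.shiftedProd_ne_zero 0 (v := x + δ / 2 + a₃) (by push_cast; ring) M
  rw [← eq_div_iff n₅] at hR
  rw [hD, hR] at hL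
  have hsq : ((-1 : ℂ) ^ N) ≠ 0 := pow_ne_zero _ (by norm_num)
  generalize shiftedProd s δ (x + y + δ / 2) M = X₁ at *
  generalize shiftedProd s δ (x + y + δ / 2) N = X₂ at *
  generalize shiftedProd s δ (y - x + δ / 2 - M * δ) M = X₃ at *
  generalize shiftedProd s δ (y - x + δ / 2) N = X₄ at *
  generalize shiftedProd s δ (2 * y + δ) N = X₅ at *
  generalize shiftedProd s δ (x + δ / 2 + a₀) M = Y₀ at *
  generalize shiftedProd s δ (x + δ / 2 + a₁) M = Y₁ at *
  generalize shiftedProd s δ (x + δ / 2 + a₂) M = Y₂ at *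
  generalize shiftedProd s δ (x + δ / 2 + a₃) M = Y₃ at *
  generalize shiftedProd s δ (2 * x + δ) M = X₆ at *
  generalize shiftedProd s δ (y - x + δ / 2 - M * δ) N = X₇ at *
  generalize shiftedProd s δ (y + δ / 2 + (δ / 2 - a₀)) N = Z₀ at *
  generalize shiftedProd s δ (y + δ / 2 + (δ / 2 - a₁)) N = Z₁ at *
  generalize shiftedProd s δ (y + δ / 2 + (δ / 2 - a₂)) N = Z₂ at *
  generalize shiftedProd s δ (y + δ / 2 + (δ / 2 - a₃)) N = Z₃ at *
  generalize seriesSum s δ M N x y a₀ a₁ a₂ a₃ = S at *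
  generalize seriesSum s δ N M y x (δ / 2 - a₀) (δ / 2 - a₁) (δ / 2 - a₂) (δ / 2 - a₃) = T at *
  generalize dualRatio s δ (a₀ + a₁) M N = R₁ at *
  generalize dualRatio s δ (a₀ + a₂) M N = R₂ at *
  generalize dualRatio s δ (a₀ + a₃) M N = R₃ at *
  generalize (-1 : ℂ) ^ N = ε at *
  clear hrev hg hg' hD hR hbal
  have hn : Y₀ * Y₁ * Y₂ * Y₃ * (X₂ * (ε * X₄)) ≠ 0 := by positivity
  refine mul_right_cancel₀ hn (hL.symm.trans ?_)
  field_simp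

end

/-! ### Removing genericity by continuity. -/

theorem continuous_shiftedProd {s : ℂ → ℂ} (hs : Continuous s) (δ : ℂ) (k : ℕ) :
    Continuous fun u ↦ shiftedProd s δ u k :=
  continuous_finsetProd _ fun _ _ ↦ hs.comp (continuous_add_const _)

theorem continuousAt_shiftedProd_div {s : ℂ → ℂ} (hs : Continuous s) {δ : ℂ} {f g : ℂ → ℂ}
    (hf : Continuous f) (hg : Continuous g) {t : ℂ} (m k : ℕ)
    (h : shiftedProd s δ (g t) k ≠ 0) :
    ContinuousAt (fun t ↦ shiftedProd s δ (f t) m / shiftedProd s δ (g t) k) t :=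
  ((continuous_shiftedProd hs δ m).comp hf).continuousAt.div
    ((continuous_shiftedProd hs δ k).comp hg).continuousAt h

theorem continuousAt_seriesSum {s : ℂ → ℂ} (hs : Continuous s) {δ : ℂ} {M N : ℕ}
    {x y a₀ a₁ a₂ a₃ : ℂ → ℂ} {t : ℂ}
    (hx : Continuous x) (hy : Continuous y) (ha₀ : Continuous a₀) (ha₁ : Continuous a₁)
    (ha₂ : Continuous a₂) (ha₃ : Continuous a₃)
    (hδ : ∀ n : ℕ, s (δ + n * δ) ≠ 0) (h : s (2 * x t) ≠ 0)
    (h₀ : shiftedProd s δ (x t + δ / 2 + a₀ t) M ≠ 0)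
    (h₁ : shiftedProd s δ (x t + δ / 2 + a₁ t) M ≠ 0)
    (h₂ : shiftedProd s δ (x t + δ / 2 + a₂ t) M ≠ 0)
    (h₃ : shiftedProd s δ (x t + δ / 2 + a₃ t) M ≠ 0)
    (h₄ : shiftedProd s δ (x t - y t + δ / 2 - N * δ) M ≠ 0)
    (h₅ : shiftedProd s δ (x t + y t + δ / 2) M ≠ 0)
    (h₆ : shiftedProd s δ (2 * x t + δ + M * δ) M ≠ 0) :
    ContinuousAt (fun t ↦ seriesSum s δ M N (x t) (y t) (a₀ t) (a₁ t) (a₂ t) (a₃ t)) t := by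
  refine tendsto_finsetSum _ fun k hk ↦ ?_
  have hk : k ≤ M := Nat.lt_succ_iff.1 (Finset.mem_range.1 hk)
  refine ContinuousAt.mul (ContinuousAt.mul (ContinuousAt.div ?_ ?_ h) ?_) ?_
  · exact (hs.comp (by fun_prop)).continuousAt
  · exact (hs.comp (by fun_prop)).continuousAt
  · exact continuousAt_shiftedProd_div hs (by fun_prop) continuous_const k k
      (Finset.prod_ne_zero_iff.2 fun j _ ↦ hδ j)
  refine ContinuousAt.mul ?_ (ContinuousAt.mul ?_ (ContinuousAt.mul ?_ (ContinuousAt.mul ?_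
    (ContinuousAt.mul ?_ (ContinuousAt.mul ?_ ?_)))))
  · exact continuousAt_shiftedProd_div hs (by fun_prop) (by fun_prop) k k
      (shiftedProd_ne_zero_of_le k h₀ hk)
  · exact continuousAt_shiftedProd_div hs (by fun_prop) (by fun_prop) k k
      (shiftedProd_ne_zero_of_le k h₁ hk)
  · exact continuousAt_shiftedProd_div hs (by fun_prop) (by fun_prop) k k
      (shiftedProd_ne_zero_of_le k h₂ hk)
  · exact continuousAt_shiftedProd_div hs (by fun_prop) (by fun_prop) k k
      (shiftedProd_ne_zero_of_le k h₃ hk)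
  · exact continuousAt_shiftedProd_div hs (by fun_prop) (by fun_prop) k k
      (shiftedProd_ne_zero_of_le k h₄ hk)
  · exact continuousAt_shiftedProd_div hs (by fun_prop) (by fun_prop) k k
      (shiftedProd_ne_zero_of_le k h₅ hk)
  · exact continuousAt_shiftedProd_div hs continuous_const (by fun_prop) k k
      (shiftedProd_ne_zero_of_le k h₆ hk)

theorem eventually_nonvanishingOn (L : PeriodPair) (c δ u : ℂ) {α : ℂ} (hα : α ≠ 0) {f : ℂ → ℂ}
    (hf : ∀ t, f t = u + α * t) :
    ∀ᶠ t in cocountable, NonvanishingOn (bracket L c) δ (f t) := by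
  have hinj (n : ℤ) : Function.Injective fun t ↦ f t + n * δ := fun t t' h ↦ by
    simpa [hf, hα] using h
  refine mem_cocountable.2 ((Set.countable_iUnion fun n : ℤ ↦
    (countable_lattice L).preimage (hinj n)).mono fun t ht ↦ ?_)
  simpa [NonvanishingOn, bracket_eq_zero_iff] using ht

theorem bracket_base_ne_zero (L : PeriodPair) (c : ℂ) {δ : ℂ} (hδ : δ ≠ 0)
    (hδL : ∀ n : ℤ, (n : ℂ) * δ ∈ L.lattice → (n : ℂ) * δ = 0) (n : ℕ) :
    bracket L c (δ + n * δ) ≠ 0 := by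
  rw [Ne, bracket_eq_zero_iff]
  intro h
  have e : δ + n * δ = ((n + 1 : ℤ) : ℂ) * δ := by push_cast; ring
  have h0 := hδL (n + 1) (e ▸ h)
  rcases mul_eq_zero.1 h0 with h1 | h1
  · have : (n : ℤ) + 1 = 0 := by exact_mod_cast h1
    omega
  · exact hδ h1

/-- The slopes 10, 20, 3, -1, -1, -1 give nonzero slope to every linear form in `Generic` that
depends on x, y or the parameters. Each such form then meets the countable set of lattice translates
by ℤδ for only countably many t. -/
theorem eventually_generic (L : PeriodPair) (c : ℂ) {δ : ℂ} (hδ : δ ≠ 0)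
    (hδL : ∀ n : ℤ, (n : ℂ) * δ ∈ L.lattice → (n : ℂ) * δ = 0) (x y a₀ a₁ a₂ a₃ : ℂ) :
    ∀ᶠ t in cocountable, Generic (bracket L c) δ (x + 10 * t) (y + 20 * t)
      (a₀ + 3 * t) (a₁ - t) (a₂ - t) (a₃ - t) := by
  have key (u α : ℂ) (hα : α ≠ 0) (f : ℂ → ℂ) (hf : ∀ t, f t = u + α * t) :=
    eventually_nonvanishingOn L c δ u hα hf
  have param (a α : ℂ) (h₁ : 10 + α ≠ 0) (h₂ : 10 - α ≠ 0) (h₃ : 20 + α ≠ 0) (h₄ : 20 - α ≠ 0)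
      (f : ℂ → ℂ) (hf : ∀ t, f t = a + α * t) : ∀ᶠ t in cocountable,
      GenericParam (bracket L c) δ (x + 10 * t) (y + 20 * t) (f t) := by
    filter_upwards [key (x + δ / 2 + a) _ h₁ (fun t ↦ x + 10 * t + δ / 2 + f t)
        (fun t ↦ by rw [hf]; ring),
      key (x + δ / 2 - a) _ h₂ (fun t ↦ x + 10 * t + δ / 2 - f t) (fun t ↦ by rw [hf]; ring),
      key (y + a) _ h₃ (fun t ↦ y + 20 * t + f t) (fun t ↦ by rw [hf]; ring),
      key (y - a) _ h₄ (fun t ↦ y + 20 * t - f t) (fun t ↦ by rw [hf]; ring)]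
      with t g₁ g₂ g₃ g₄ using ⟨g₁, g₂, g₃, g₄⟩
  filter_upwards [
    key (2 * x) 20 (by norm_num) (fun t ↦ 2 * (x + 10 * t)) (fun t ↦ by ring),
    key (2 * y) 40 (by norm_num) (fun t ↦ 2 * (y + 20 * t)) (fun t ↦ by ring),
    key (x + y + δ / 2) 30 (by norm_num) (fun t ↦ x + 10 * t + (y + 20 * t) + δ / 2)
      (fun t ↦ by ring),
    key (y - x + δ / 2) 10 (by norm_num) (fun t ↦ y + 20 * t - (x + 10 * t) + δ / 2)
      (fun t ↦ by ring),
    param a₀ 3 (by norm_num) (by norm_num) (by norm_num) (by norm_num) (fun t ↦ a₀ + 3 * t)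
      (fun t ↦ by ring),
    param a₁ (-1) (by norm_num) (by norm_num) (by norm_num) (by norm_num) (fun t ↦ a₁ - t)
      (fun t ↦ by ring),
    param a₂ (-1) (by norm_num) (by norm_num) (by norm_num) (by norm_num) (fun t ↦ a₂ - t)
      (fun t ↦ by ring),
    param a₃ (-1) (by norm_num) (by norm_num) (by norm_num) (by norm_num) (fun t ↦ a₃ - t)
      (fun t ↦ by ring),
    key (a₀ - a₁) 4 (by norm_num) (fun t ↦ a₀ + 3 * t - (a₁ - t)) (fun t ↦ by ring),
    key (a₀ + a₁) 2 (by norm_num) (fun t ↦ a₀ + 3 * t + (a₁ - t)) (fun t ↦ by ring),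
    key (a₀ + a₂) 2 (by norm_num) (fun t ↦ a₀ + 3 * t + (a₂ - t)) (fun t ↦ by ring),
    key (a₀ + a₃) 2 (by norm_num) (fun t ↦ a₀ + 3 * t + (a₃ - t)) (fun t ↦ by ring),
    key (a₂ + a₃) (-2) (by norm_num) (fun t ↦ a₂ - t + (a₃ - t)) (fun t ↦ by ring)]
    with t g₁ g₂ g₃ g₄ g₅ g₆ g₇ g₈ g₉ g₁₀ g₁₁ g₁₂ g₁₃
  exact ⟨bracket_base_ne_zero L c hδ hδL, g₁, g₂, g₃, g₄, g₅, g₆, g₇, g₈, g₉, g₁₀, g₁₁, g₁₂, g₁₃⟩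

theorem frequently_nhds_of_eventually_cocountable {p : ℂ → Prop}
    (h : ∀ᶠ t in cocountable, p t) (z : ℂ) : ∃ᶠ t in 𝓝 z, p t := by
  have hd := Set.Countable.dense_compl ℝ (mem_cocountable.1 h)
  rw [compl_compl] at hd
  exact mem_closure_iff_frequently.1 (hd z)

/-- The duality transformation whenever no denominator vanishes. -/
theorem seriesSum_bracket_duality (L : PeriodPair) (c : ℂ) {δ : ℂ} (hδ : δ ≠ 0)
    (hδL : ∀ n : ℤ, (n : ℂ) * δ ∈ L.lattice → (n : ℂ) * δ = 0)
    (M N : ℕ) (x y : ℂ) (a b : Fin 4 → ℂ) (hb : ∀ p, b p = δ / 2 - a p)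
    (hbal : a 0 + a 1 + a 2 + a 3 = ((N : ℂ) - (M : ℂ) + 1) * δ)
    (hx : bracket L c (2 * x) ≠ 0)
    (hxa : ∀ p, shiftedProd (bracket L c) δ (x + δ / 2 + a p) M ≠ 0)
    (hxy₁ : shiftedProd (bracket L c) δ (x - y + δ / 2 - N * δ) M ≠ 0)
    (hxy₂ : shiftedProd (bracket L c) δ (x + y + δ / 2) M ≠ 0)
    (hxM : shiftedProd (bracket L c) δ (2 * x + δ + M * δ) M ≠ 0)
    (hy : bracket L c (2 * y) ≠ 0)
    (hyb : ∀ p, shiftedProd (bracket L c) δ (y + δ / 2 + b p) N ≠ 0)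
    (hyx₁ : shiftedProd (bracket L c) δ (y - x + δ / 2 - M * δ) N ≠ 0)
    (hyx₂ : shiftedProd (bracket L c) δ (y + x + δ / 2) N ≠ 0)
    (hyN : shiftedProd (bracket L c) δ (2 * y + δ + N * δ) N ≠ 0)
    (hpa : ∀ p : Fin 3, shiftedProd (bracket L c) δ ((1 - M) * δ - a 0 - a p.succ) N ≠ 0)
    (hpy : shiftedProd (bracket L c) δ (2 * y + δ) N ≠ 0)
    (hpyx : shiftedProd (bracket L c) δ (y - x + δ / 2) N ≠ 0) :
    seriesSum (bracket L c) δ M N x y (a 0) (a 1) (a 2) (a 3) =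
      (∏ p : Fin 3, shiftedProd (bracket L c) δ (a 0 + a p.succ) M /
          shiftedProd (bracket L c) δ ((1 - M) * δ - a 0 - a p.succ) N) *
      (∏ p : Fin 4, shiftedProd (bracket L c) δ (y + δ / 2 + b p) N /
          shiftedProd (bracket L c) δ (x + δ / 2 + a p) M) *
      (shiftedProd (bracket L c) δ (2 * x + δ) M / shiftedProd (bracket L c) δ (2 * y + δ) N) *
      (shiftedProd (bracket L c) δ (y - x + δ / 2 - M * δ) N /
          shiftedProd (bracket L c) δ (y - x + δ / 2) N) *
      seriesSum (bracket L c) δ N M y x (b 0) (b 1) (b 2) (b 3) := by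
  obtain rfl : b = fun p ↦ δ / 2 - a p := funext hb
  have hs := continuous_bracket L c
  have hbase := bracket_base_ne_zero L c hδ hδL
  set s := bracket L c with hsdef
  -- The entries sum to zero, so balancing holds along the whole line.
  let v : Fin 4 → ℂ := ![3, -1, -1, -1]
  let A : ℂ → Fin 4 → ℂ := fun t p ↦ a p + v p * t
  have hA (p : Fin 4) : Continuous fun t ↦ A t p := by simp only [A]; fun_prop
  have hA0 (p : Fin 4) : A 0 p = a p := by simp [A]
  let X : ℂ → ℂ := fun t ↦ x + 10 * t
  let Y : ℂ → ℂ := fun t ↦ y + 20 * t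
  have hX : Continuous X := by simp only [X]; fun_prop
  have hY : Continuous Y := by simp only [Y]; fun_prop
  have hX0 : X 0 = x := by simp [X]
  have hY0 : Y 0 = y := by simp [Y]
  have hf : ContinuousAt
      (fun t ↦ seriesSum s δ M N (X t) (Y t) (A t 0) (A t 1) (A t 2) (A t 3)) 0 := by
    apply continuousAt_seriesSum hs hX hY (hA 0) (hA 1) (hA 2) (hA 3) hbase <;>
      simp only [hX0, hY0, hA0]
    exacts [hx, hxa 0, hxa 1, hxa 2, hxa 3, hxy₁, hxy₂, hxM]
  have hg : ContinuousAt
      (fun t ↦ seriesSum s δ N M (Y t) (X t) (δ / 2 - A t 0) (δ / 2 - A t 1) (δ / 2 - A t 2)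
        (δ / 2 - A t 3)) 0 := by
    apply continuousAt_seriesSum (a₀ := fun t ↦ δ / 2 - A t 0) (a₁ := fun t ↦ δ / 2 - A t 1)
      (a₂ := fun t ↦ δ / 2 - A t 2) (a₃ := fun t ↦ δ / 2 - A t 3) hs hY hX
      (continuous_const.sub (hA 0)) (continuous_const.sub (hA 1)) (continuous_const.sub (hA 2)) (continuous_const.sub (hA 3))
      hbase <;> simp only [hX0, hY0, hA0]
    exacts [hy, hyb 0, hyb 1, hyb 2, hyb 3, hyx₁, hyx₂, hyN]
  have h₁ : ContinuousAt (fun t ↦ ∏ p : Fin 3, shiftedProd s δ (A t 0 + A t p.succ) M /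
      shiftedProd s δ ((1 - M) * δ - A t 0 - A t p.succ) N) 0 :=
    tendsto_finsetProd _ fun p _ ↦ continuousAt_shiftedProd_div hs ((hA 0).add (hA _))
      ((continuous_const.sub (hA 0)).sub (hA _)) M N (by simpa only [Pi.sub_apply, hA0] using hpa p)
  have h₂ : ContinuousAt (fun t ↦ ∏ p : Fin 4, shiftedProd s δ (Y t + δ / 2 + (δ / 2 - A t p)) N /
      shiftedProd s δ (X t + δ / 2 + A t p) M) 0 :=
    tendsto_finsetProd _ fun p _ ↦ continuousAt_shiftedProd_div hs
      ((hY.add continuous_const).add (continuous_const.sub (hA _)))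
      ((hX.add continuous_const).add (hA _)) N M (by simpa only [Pi.add_apply, hX0, hA0] using hxa p)
  have h₃ : ContinuousAt (fun t ↦ shiftedProd s δ (2 * X t + δ) M /
      shiftedProd s δ (2 * Y t + δ) N) 0 :=
    continuousAt_shiftedProd_div hs (by fun_prop) (by fun_prop) M N (by simpa only [hY0] using hpy)
  have h₄ : ContinuousAt (fun t ↦ shiftedProd s δ (Y t - X t + δ / 2 - M * δ) N /
      shiftedProd s δ (Y t - X t + δ / 2) N) 0 :=
    continuousAt_shiftedProd_div hs (by fun_prop) (by fun_prop) N N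
      (by simpa only [hX0, hY0] using hpyx)
  have hG := (((h₁.mul h₂).mul h₃).mul h₄).mul hg
  have hev := (eventually_generic L c hδ hδL x y (a 0) (a 1) (a 2) (a 3)).mono fun t ht ↦ by
    have e₀ : A t 0 = a 0 + 3 * t := by simp [A, v]
    have e₁ : A t 1 = a 1 - t := by simp [A, v]; ring
    have e₂ : A t 2 = a 2 - t := by simp [A, v]; ring
    have e₃ : A t 3 = a 3 - t := by simp [A, v]; ring
    rw [← e₀, ← e₁, ← e₂, ← e₃] at ht
    have h := seriesSum_duality (isThetaBracket_bracket L c) ht (M := M) (N := N)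
      (by rw [e₀, e₁, e₂, e₃, ← hbal]; ring)
    simp only [dualRatio, ← sub_sub ((1 - (M : ℂ)) * δ)] at h
    exact h
  -- Both sides are continuous at t = 0 by the nonvanishing hypotheses and agree at generic t
  -- arbitrarily close to 0.
  have h := tendsto_nhds_unique_of_frequently_eq hf hG
    ((frequently_nhds_of_eventually_cocountable hev 0).mono fun t ht ↦ by
      simp only [Pi.mul_apply, Fin.prod_univ_three, Fin.prod_univ_four]
      exact ht)
  simpa only [Pi.mul_apply, hX0, hY0, hA0] using h

theorem ellipticV_eq_seriesSum (L : PeriodPair) (c δ : ℂ) (M N : ℕ) (x y a₀ a₁ a₂ a₃ : ℂ) :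
    ellipticV L c δ (2 * x) ![x + δ / 2 - a₀, x + δ / 2 - a₁, x + δ / 2 - a₂, x + δ / 2 - a₃,
      x + y + δ / 2 + N * δ, x - y + δ / 2, -(M * δ)] =
      seriesSum (bracket L c) δ M N x y a₀ a₁ a₂ a₃ := by
  have hterm (k : ℕ) : bracket L c (2 * x + 2 * (k : ℂ) * δ) / bracket L c (2 * x) *
      (shiftedFactorial L c δ (2 * x) k / shiftedFactorial L c δ δ k) *
      ∏ i, shiftedFactorial L c δ ((![x + δ / 2 - a₀, x + δ / 2 - a₁, x + δ / 2 - a₂,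
        x + δ / 2 - a₃, x + y + δ / 2 + N * δ, x - y + δ / 2, -(M * δ)] : Fin 7 → ℂ) i) k /
        shiftedFactorial L c δ (δ + 2 * x - (![x + δ / 2 - a₀, x + δ / 2 - a₁, x + δ / 2 - a₂,
        x + δ / 2 - a₃, x + y + δ / 2 + N * δ, x - y + δ / 2, -(M * δ)] : Fin 7 → ℂ) i) k =
      seriesTerm (bracket L c) δ M N x y a₀ a₁ a₂ a₃ k := by
    have e (a : ℂ) : δ + 2 * x - (x + δ / 2 - a) = x + δ / 2 + a := by ring
    have e₁ : δ + 2 * x - (x + y + δ / 2 + N * δ) = x - y + δ / 2 - N * δ := by ring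
    have e₂ : δ + 2 * x - (x - y + δ / 2) = x + y + δ / 2 := by ring
    have e₃ : δ + 2 * x - -(M * δ) = 2 * x + δ + M * δ := by ring
    simp only [Fin.prod_univ_succ, Fin.prod_univ_zero, mul_one, Matrix.cons_val_zero,
      Matrix.cons_val_succ, e, e₁, e₂, e₃]
    rfl
  rw [ellipticV, seriesSum]
  simp only [hterm]
  refine tsum_eq_sum fun k hk ↦ ?_
  have hk : M < k := by simpa [Nat.lt_succ_iff] using hk
  -- For k > M the factor with index M is s(0) = 0, which truncates the series.
  have h0 : shiftedProd (bracket L c) δ (-(M * δ)) k = 0 :=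
    Finset.prod_eq_zero (Finset.mem_range.2 hk)
      (by rw [neg_add_cancel]; exact (isThetaBracket_bracket L c).zero)
  simp [seriesTerm, h0]

end EllipticHypergeometric

open EllipticHypergeometric in
theorem mainTheorem10
    (L : PeriodPair) (c δ : ℂ) (hδ : δ ≠ 0)
    (hδL : ∀ n : ℤ, (n : ℂ) * δ ∈ L.lattice → (n : ℂ) * δ = 0)
    (M N : ℕ) (x y : ℂ) (a b : Fin 4 → ℂ)
    (hb : ∀ p, b p = δ / 2 - a p)
    (hbal : ∑ p, a p = ((N : ℂ) - (M : ℂ) + 1) * δ)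
    -- the denominators of the series on the left do not vanish
    (hx : bracket L c (2 * x) ≠ 0)
    (hxa : ∀ p, shiftedFactorial L c δ (x + δ / 2 + a p) M ≠ 0)
    (hxy₁ : shiftedFactorial L c δ (x - y + δ / 2 - N * δ) M ≠ 0)
    (hxy₂ : shiftedFactorial L c δ (x + y + δ / 2) M ≠ 0)
    (hxM : shiftedFactorial L c δ (2 * x + δ + M * δ) M ≠ 0)
    -- the denominators of the series on the right do not vanish
    (hy : bracket L c (2 * y) ≠ 0)
    (hyb : ∀ p, shiftedFactorial L c δ (y + δ / 2 + b p) N ≠ 0)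
    (hyx₁ : shiftedFactorial L c δ (y - x + δ / 2 - M * δ) N ≠ 0)
    (hyx₂ : shiftedFactorial L c δ (y + x + δ / 2) N ≠ 0)
    (hyN : shiftedFactorial L c δ (2 * y + δ + N * δ) N ≠ 0)
    -- the remaining denominators of the prefactor do not vanish
    (hpa : ∀ p : Fin 3, shiftedFactorial L c δ ((1 - M) * δ - a 0 - a p.succ) N ≠ 0)
    (hpy : shiftedFactorial L c δ (2 * y + δ) N ≠ 0)
    (hpyx : shiftedFactorial L c δ (y - x + δ / 2) N ≠ 0) :
    ellipticV L c δ (2 * x)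
        ![x + δ / 2 - a 0, x + δ / 2 - a 1, x + δ / 2 - a 2, x + δ / 2 - a 3,
          x + y + δ / 2 + N * δ, x - y + δ / 2, -(M * δ)]
      = (∏ p : Fin 3, shiftedFactorial L c δ (a 0 + a p.succ) M /
            shiftedFactorial L c δ ((1 - M) * δ - a 0 - a p.succ) N) *
        (∏ p : Fin 4, shiftedFactorial L c δ (y + δ / 2 + b p) N /
            shiftedFactorial L c δ (x + δ / 2 + a p) M) *
        (shiftedFactorial L c δ (2 * x + δ) M / shiftedFactorial L c δ (2 * y + δ) N) *
        (shiftedFactorial L c δ (y - x + δ / 2 - M * δ) N /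
            shiftedFactorial L c δ (y - x + δ / 2) N) *
        ellipticV L c δ (2 * y)
          ![y + δ / 2 - b 0, y + δ / 2 - b 1, y + δ / 2 - b 2, y + δ / 2 - b 3,
            y + x + δ / 2 + M * δ, y - x + δ / 2, -(N * δ)] := by
  rw [ellipticV_eq_seriesSum, ellipticV_eq_seriesSum]
  exact seriesSum_bracket_duality L c hδ hδL M N x y a b hb (by rw [← hbal, Fin.sum_univ_four])
    hx hxa hxy₁ hxy₂ hxM hy hyb hyx₁ hyx₂ hyN hpa hpy hpyx
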